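/- Let $l$ be a prime, let $k/k'$ be an extension of finite fields of degree $l$ and of characteristic different from $l$, and let $n\ge 2$. Write $\overline{\mathbb Z_l}$ for the integral closure of $\mathbb Z_l$ in an algebraic closure $\overline{\mathbb Q_l}$ of $\mathbb Q_l$, and let $\mathrm{Frob}$ act on $\mathrm{GL}_n(k)$ entrywise by $x\mapsto x^{|k'|}$. Let $(\rho,V)$ be an irreducible representation of $\mathrm{GL}_n(k)$ over $\overline{\mathbb Q_l}$ such that: - $\rho$ is cuspidal: for every $1\le m\le n-1$ and every representation $\tau$ of the Levi factor $\mathrm{GL}_m(k)\times\mathrm{GL}_{n-m}(k)$ of the standard maximal parabolic subgroup $P_m$, inflated to $P_m$, one has $\mathrm{Hom}_{\mathrm{GL}_n(k)}\big(\rho,\mathrm{Ind}_{P_m}^{\mathrm{GL}_n(k)}\tau\big)=0$; - $\rho$ is integral: $V$ contains a $\mathrm{GL}_n(k)$-stable $\overline{\mathbb Z_l}$-lattice, i.e. a stable finitely generated $\overline{\mathbb Z_l}$-submodule spanning $V$ over $\overline{\mathbb Q_l}$; - $\rho$ is Frobenius-fixed: $\rho\cong\rho\circ\mathrm{Frob}$.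 Let $\varepsilon:k'\to\overline{\mathbb Q_l}^{\times}$ be a nontrivial additive character, and let $\psi(u)=\varepsilon\big(\mathrm{Tr}_{k/k'}(u_{1,2}+\dots+u_{n-1,n})\big)$ be the corresponding character of the group $U_n$ of upper triangular unipotent matrices in $\mathrm{GL}_n(k)$. Then there is exactly one $\overline{\mathbb Q_l}$-linear operator $T:V\to V$ such that $T\rho(g)=\rho(\mathrm{Frob}(g))T$ for all $g\in\mathrm{GL}_n(k)$, $T^l=1$, and $Tv=v$ for every $v\in V$ with $\rho(u)v=\psi(u)v$ for all $u\in U_n$. For this operator and for every $\mathrm{GL}_n(k)$-stable $\overline{\mathbb Z_l}$-lattice $L\subset V$ one has $T(L)\subseteq L$, and the Tate cohomology $$T^1(L)=\ker\big(1+T+\dots+T^{l-1}:L\to L\big)\big/(1-T)L$$ is zero. In other words, $T^1(\rho)=0$. -/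

import Mathlib

open scoped MatrixGroups

noncomputable section

namespace TateGL

universe u v w

/-- An algebraic closure of the field of `l`-adic numbers. -/
abbrev QlBar (l : ℕ) [Fact l.Prime] : Type := AlgebraicClosure ℚ_[l]

/-- The integral closure of the `l`-adic integers in `QlBar l`. -/
abbrev ZlBar (l : ℕ) [Fact l.Prime] : Subalgebra ℤ_[l] (QlBar l) :=
  integralClosure ℤ_[l] (QlBar l)

section Groups

variable {k : Type v} [Field k] {n : ℕ}

/-- The maximal standard parabolic subgroup of `GL_n(k)` of matrices whose lower left
`(n - m) × m` block vanishes. -/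
def parabolic (k : Type v) [Field k] (n m : ℕ) : Subgroup (GL (Fin n) k) where
  carrier := {g | (g : Matrix (Fin n) (Fin n) k).BlockTriangular
    fun i => decide (m ≤ (i : ℕ))}
  mul_mem' {a b} ha hb := by
    simp only [Set.mem_ofPred_eq, Units.val_mul] at ha hb ⊢
    exact ha.mul hb
  one_mem' := Matrix.blockTriangular_one
  inv_mem' {a} ha := by
    simp only [Set.mem_ofPred_eq] at ha ⊢
    have : Invertible (a : Matrix (Fin n) (Fin n) k) := a.invertible
    rw [Matrix.coe_units_inv]
    exact Matrix.blockTriangular_inv_of_blockTriangular ha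

/-- Membership in the unipotent radical of `parabolic k n m`: `g` agrees with the identity
outside the upper right `m × (n - m)` block. -/
def InUnipotentRadical (m : ℕ) (g : GL (Fin n) k) : Prop :=
  ∀ i j : Fin n, ¬ ((i : ℕ) < m ∧ m ≤ (j : ℕ)) →
    (g : Matrix (Fin n) (Fin n) k) i j = (1 : Matrix (Fin n) (Fin n) k) i j

/-- Membership in the group `U_n` of upper triangular unipotent matrices. -/
def IsUnipotentUpper (g : GL (Fin n) k) : Prop :=
  ∀ i j : Fin n, j ≤ i →
    (g : Matrix (Fin n) (Fin n) k) i j = (1 : Matrix (Fin n) (Fin n) k) i j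

/-- The sum of the entries `g_{1,2} + g_{2,3} + ⋯ + g_{n-1,n}` just above the diagonal. -/
def superdiagSum (g : GL (Fin n) k) : k :=
  ∑ i : Fin n, ∑ j : Fin n,
    if (j : ℕ) = i + 1 then (g : Matrix (Fin n) (Fin n) k) i j else 0

/-- The entrywise action on `GL_n(k)` of the Frobenius `x ↦ x ^ |k'|` of `k` over `k'`. -/
def frobGL (k' : Type w) [Field k'] [Fintype k'] (k : Type v) [Field k] [Algebra k' k] (n : ℕ) :
    GL (Fin n) k →* GL (Fin n) k :=
  Matrix.GeneralLinearGroup.map (FiniteField.frobeniusAlgHom k' k : k →+* k)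

end Groups

section Representations

variable {K : Type w} [Field K] {k : Type v} [Field k] {n : ℕ}
  {V : Type u} [AddCommGroup V] [Module K V]

/-- `ρ` is cuspidal: there is no nonzero `GL_n(k)`-homomorphism from `ρ` to a representation
parabolically induced from a maximal standard parabolic subgroup. A representation of the Levi
factor, inflated to the parabolic, is the same as a representation `τ` of the parabolic that is
trivial on its unipotent radical. The induced representation is the space of functions
`f : GL_n(k) → W` with `f (p g) = τ p (f g)`, with `GL_n(k)` acting by right translation. -/
def IsCuspidal (ρ : Representation K (GL (Fin n) k) V) : Prop :=
  ∀ m : ℕ, 1 ≤ m → m < n →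
    ∀ (W : Type u) [AddCommGroup W] [Module K W] (τ : Representation K (parabolic k n m) W),
      (∀ p : parabolic k n m, InUnipotentRadical m (p : GL (Fin n) k) → τ p = 1) →
        ∀ f : ρ.IntertwiningMap (Representation.coind (parabolic k n m).subtype τ), f = 0

end Representations

section Tate

variable {R : Type*} [CommRing R] {M : Type*} [AddCommGroup M] [Module R M]

/-- The norm `1 + T + ⋯ + T ^ (l - 1)`. -/
def tateNorm (l : ℕ) (T : Module.End R M) : Module.End R M :=
  ∑ i ∈ Finset.range l, T ^ i

/-- The Tate cohomology `T¹ = ker (1 + T + ⋯ + T ^ (l - 1)) / im (1 - T)` of an endomorphism `T`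
with `T ^ l = 1`. -/
abbrev TateH1 (l : ℕ) (T : Module.End R M) : Type _ :=
  LinearMap.ker (tateNorm l T) ⧸
    (LinearMap.range (1 - T)).submoduleOf (LinearMap.ker (tateNorm l T))

end Tate

section Integral

variable {l : ℕ} [Fact l.Prime] {k' : Type w} [Field k'] [Fintype k']
  {k : Type v} [Field k] [Algebra k' k] {n : ℕ}
  {V : Type u} [AddCommGroup V] [Module (QlBar l) V]

/-- `L` is a `ZlBar l`-lattice in `V` (finitely generated and spanning `V`) that is stable
under the action of `GL_n(k)`. -/
structure IsInvariantLattice (ρ : Representation (QlBar l) (GL (Fin n) k) V)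
    (L : Submodule (ZlBar l) V) : Prop where
  isLattice : Submodule.IsLattice (QlBar l) L
  stable : ∀ (g : GL (Fin n) k), ∀ x ∈ L, ρ g x ∈ L

/-- `ρ` is integral: it admits an invariant lattice. -/
def IsIntegralRep (ρ : Representation (QlBar l) (GL (Fin n) k) V) : Prop :=
  ∃ L : Submodule (ZlBar l) V, IsInvariantLattice ρ L

/-- `ρ` is fixed by the Frobenius of `k` over `k'`: `ρ` and `ρ ∘ Frob` are isomorphic. -/
def IsFrobFixed (k' : Type w) [Field k'] [Fintype k'] [Algebra k' k]
    (ρ : Representation (QlBar l) (GL (Fin n) k) V) : Prop :=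
  Nonempty (Representation.Equiv ρ (MonoidHom.comp ρ (frobGL k' k n)))

/-- `T` is an isomorphism from `ρ` to `ρ ∘ Frob` with `T ^ l = 1`, normalized by the requirement
that it fixes every vector of `V` on which the group `U_n` of upper triangular unipotent matrices
acts through the character `u ↦ ε (Tr_{k/k'} (u_{1,2} + ⋯ + u_{n-1,n}))`. -/
structure IsFrobOperator (ρ : Representation (QlBar l) (GL (Fin n) k) V)
    (ε : AddChar k' (QlBar l)) (T : Module.End (QlBar l) V) : Prop where
  intertwines : ∀ (g : GL (Fin n) k) (x : V), T (ρ g x) = ρ (frobGL k' k n g) (T x)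
  pow_eq_one : T ^ l = 1
  normalized : ∀ x : V,
    (∀ u : GL (Fin n) k, IsUnipotentUpper u →
      ρ u x = ε (Algebra.trace k' k (superdiagSum u)) • x) → T x = x

end Integral

end TateGL

end

/-! Filter `V` by partial Whittaker conditions. Let `U_c` be the group of unipotent matrices that
are trivial in the columns before `c`, and `V_c` the space on which `U_c` acts through `ψ`
(`whittakerSpace`). Columns are numbered from 0, so `V_n = V` and `V_1 = V_0` is the space of
Whittaker vectors.

To pass from `V_{c+1}` to `V_c`, decompose `V_{c+1}` under the column group `k^c`, whose characters
are indexed by `y ∈ k^c`. The part for `y = 0` is fixed by the unipotent radical of the parabolic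
`P_c`, hence vanishes by cuspidality (`columnProj_zero`). For `y ≠ 0`, an element `q` of the
mirabolic with row `c - 1` equal to `y` carries the `y`-part into `V_c` (`IsColumnEigen.map_mem`).
The order of `k` is prime to `l`, so these projections preserve every invariant lattice.

The operator `T` permutes the parts through Frobenius on `y`, and Frobenius has prime order `l`.
Orbits of length `l` contribute nothing to `T¹` (`mem_map_one_sub_of_decomposition`). If `y ≠ 0` is
fixed by Frobenius, then `q` can be chosen fixed as well, so translation by `q` commutes with `T`
and the question descends to `V_c` (`mem_map_one_sub`). On Whittaker vectors `T = 1`, the norm is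
multiplication by `l`, and its kernel is zero. The same descent shows that `T` preserves lattices
(`map_mem_lattice`).

Existence and uniqueness of `T` rest on the Whittaker vectors forming a line. They are nonzero by
the descent above (`whittakerSpace_zero_ne_bot`). Multiplicity one is the Gelfand–Graev argument:
reflection in the antidiagonal is an anti-automorphism preserving `ψ` and acting trivially on Hecke
operators (`heckeOp_flipGL`), so these commute. An isomorphism `ρ ≅ ρ ∘ Frob` preserves the line and
is rescaled to be the identity there; irreducibility gives the rest. -/

noncomputable section

namespace TateGL

universe u v w

/-! ### Unipotent, column and mirabolic subgroups. -/

section Groups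

variable {k : Type v} [Field k] {n : ℕ}

/-- A submonoid of a finite group is a subgroup. -/
def subgroupOfFinite {G : Type*} [Group G] [Finite G] (S : Submonoid G) : Subgroup G where
  __ := S
  inv_mem' {x} hx := by
    have h : x⁻¹ ∈ Submonoid.powers x :=
      mem_powers_iff_mem_zpowers.2 (inv_mem (Subgroup.mem_zpowers x))
    exact (Submonoid.powers_le.2 hx) h

/-- The group of upper triangular unipotent matrices whose columns with index less than `c` are
those of the identity matrix. -/
def unipotentUpper (k : Type v) [Field k] [Finite k] (n c : ℕ) : Subgroup (GL (Fin n) k) :=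
  subgroupOfFinite
  { carrier := {u | ∀ i j : Fin n, (j ≤ i ∨ (j : ℕ) < c) →
      u.val i j = (1 : Matrix (Fin n) (Fin n) k) i j}
    one_mem' := fun _ _ _ => rfl
    mul_mem' := by
      intro a b ha hb i j hij
      simp only [Set.mem_ofPred_eq] at ha hb
      rw [Units.val_mul, Matrix.mul_apply]
      rcases hij with hij | hj
      · rw [Finset.sum_eq_single i, ha i i (Or.inl le_rfl), hb i j (Or.inl hij)]
        · simp
        · intro m _ hm
          rcases lt_or_gt_of_ne hm with h | h
          · rw [ha i m (Or.inl h.le), Matrix.one_apply_ne h.ne', zero_mul]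
          · rw [hb m j (Or.inl (hij.trans h.le)), Matrix.one_apply_ne (hij.trans_lt h).ne',
              mul_zero]
        · simp
      · rw [Finset.sum_congr rfl fun m _ => by rw [hb m j (Or.inr hj)], ← Matrix.mul_apply,
          mul_one, ha i j (Or.inr hj)] }

lemma mem_unipotentUpper [Finite k] {c : ℕ} {u : GL (Fin n) k} :
    u ∈ unipotentUpper k n c ↔ ∀ i j : Fin n, (j ≤ i ∨ (j : ℕ) < c) →
      u.val i j = (1 : Matrix (Fin n) (Fin n) k) i j := Iff.rfl

lemma mem_unipotentUpper_zero [Finite k] {u : GL (Fin n) k} :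
    u ∈ unipotentUpper k n 0 ↔ IsUnipotentUpper u := by
  simp [mem_unipotentUpper, IsUnipotentUpper]

/-- Column 0 has no entries above the diagonal, so it imposes no condition. -/
lemma unipotentUpper_one_eq [Finite k] : unipotentUpper k n 1 = unipotentUpper k n 0 := by
  ext u
  simp only [mem_unipotentUpper]
  refine forall₂_congr fun i j => ?_
  have : (j ≤ i ∨ (j : ℕ) < 1) ↔ (j ≤ i ∨ (j : ℕ) < 0) := by
    simp only [Fin.le_def]; omega
  rw [this]

lemma unipotentUpper_antitone [Finite k] : Antitone (unipotentUpper k n) :=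
  fun _ _ hcd _ hu i j hij => hu i j (hij.imp_right fun h => h.trans_le hcd)

lemma eq_one_of_mem_unipotentUpper [Finite k] {u : GL (Fin n) k} (hu : u ∈ unipotentUpper k n n) :
    u = 1 := by
  ext i j
  exact hu i j (Or.inr j.2)

lemma superdiagSum_one : superdiagSum (1 : GL (Fin n) k) = 0 := by
  refine Finset.sum_eq_zero fun i _ => Finset.sum_eq_zero fun j _ => ?_
  split_ifs with h
  · exact Matrix.one_apply_ne (by rintro rfl; omega)
  · rfl

lemma superdiagSum_mul [Finite k] {a b : GL (Fin n) k} (ha : a ∈ unipotentUpper k n 0)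
    (hb : b ∈ unipotentUpper k n 0) :
    superdiagSum (a * b) = superdiagSum a + superdiagSum b := by
  simp only [superdiagSum, ← Finset.sum_add_distrib]
  refine Finset.sum_congr rfl fun i _ => Finset.sum_congr rfl fun j _ => ?_
  split_ifs with h
  · have hij : i < j := by rw [Fin.lt_def]; omega
    rw [Units.val_mul, Matrix.mul_apply,
      Finset.sum_eq_add_of_mem i j (Finset.mem_univ _) (Finset.mem_univ _) hij.ne,
      ha i i (Or.inl le_rfl), hb j j (Or.inl le_rfl)]
    · simp [add_comm]
    · rintro m - ⟨hmi, hmj⟩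
      rcases lt_or_gt_of_ne hmi with h' | h'
      · rw [ha i m (Or.inl h'.le), Matrix.one_apply_ne h'.ne', zero_mul]
      · have : j < m := by
          rw [Fin.lt_def] at h' ⊢
          have := Fin.val_ne_of_ne hmj
          omega
        rw [hb m j (Or.inl this.le), Matrix.one_apply_ne this.ne', mul_zero]
  · rw [add_zero]

/-- The character of the group of upper triangular unipotent matrices attached to an additive
character of `k`, extended to a function on `GL_n(k)`. -/
def whittakerChar {K : Type*} [Field K] (ψ : AddChar k K) (g : GL (Fin n) k) : K :=
  ψ (superdiagSum g)

variable {K : Type*} [Field K] (ψ : AddChar k K)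

lemma whittakerChar_one : whittakerChar ψ (1 : GL (Fin n) k) = 1 := by
  rw [whittakerChar, superdiagSum_one, AddChar.map_zero_eq_one]

lemma whittakerChar_mul [Finite k] {a b : GL (Fin n) k} (ha : a ∈ unipotentUpper k n 0)
    (hb : b ∈ unipotentUpper k n 0) :
    whittakerChar ψ (a * b) = whittakerChar ψ a * whittakerChar ψ b := by
  rw [whittakerChar, superdiagSum_mul ha hb, AddChar.map_add_eq_mul]; rfl

lemma whittakerChar_ne_zero (g : GL (Fin n) k) : whittakerChar ψ g ≠ 0 :=
  (ψ.val_isUnit _).ne_zero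

/-- The upper triangular unipotent matrix with entries `v` above the diagonal in column `c`. -/
def columnUnipotent (c : Fin n) : Multiplicative ({i : Fin n // i < c} → k) →* GL (Fin n) k :=
  MonoidHom.toHomUnits
  { toFun := fun v => Matrix.of fun i j =>
      (1 : Matrix (Fin n) (Fin n) k) i j +
        if h : i < c then (if j = c then Multiplicative.toAdd v ⟨i, h⟩ else 0) else 0
    map_one' := by ext; simp
    map_mul' := by
      intro v w
      ext i j
      rw [Matrix.mul_apply]
      simp only [Matrix.of_apply, add_mul]
      rw [Finset.sum_add_distrib]
      have h1 : ∀ f : Fin n → k, ∑ m, (1 : Matrix (Fin n) (Fin n) k) i m * f m = f i := by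
        intro f; simp [Matrix.one_apply]
      rw [h1]
      by_cases hi : i < c
      · simp only [hi, dite_true, toAdd_mul, Pi.add_apply, ite_mul, zero_mul]
        rw [Finset.sum_ite_eq' Finset.univ c]
        simp only [Finset.mem_univ, if_true, lt_irrefl, dite_false, add_zero, Matrix.one_apply]
        by_cases hj : j = c
        · subst hj; simp; ring
        · simp [hj, Ne.symm hj]
      · simp [hi] }

lemma columnUnipotent_apply (c : Fin n) (v : {i : Fin n // i < c} → k) (i j : Fin n) :
    (columnUnipotent c (Multiplicative.ofAdd v)).val i j =
      (1 : Matrix (Fin n) (Fin n) k) i j +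
        if h : i < c then (if j = c then v ⟨i, h⟩ else 0) else 0 := rfl

lemma columnUnipotent_mem [Finite k] (c : Fin n) (v : {i : Fin n // i < c} → k) :
    columnUnipotent c (Multiplicative.ofAdd v) ∈ unipotentUpper k n c := by
  intro i j hij
  rw [columnUnipotent_apply]
  split_ifs with h1 h2
  · subst h2
    exact absurd hij (by simp only [Fin.le_def, Fin.lt_def] at *; omega)
  · simp
  · simp

lemma superdiagSum_columnUnipotent {c : Fin n} (hc : 0 < (c : ℕ))
    (v : {i : Fin n // i < c} → k) :
    superdiagSum (columnUnipotent c (Multiplicative.ofAdd v)) =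
      v ⟨⟨c - 1, by omega⟩, by rw [Fin.lt_def]; simp; omega⟩ := by
  rw [superdiagSum, Finset.sum_eq_single ⟨c - 1, by omega⟩, Finset.sum_eq_single c]
  · rw [if_pos (by simp; omega), columnUnipotent_apply, Matrix.one_apply_ne, zero_add,
      dif_pos, if_pos rfl]
    rw [Ne, Fin.ext_iff]; simp; omega
  · intro j _ hj
    rw [if_neg]
    intro h; apply hj; ext; simp at h; omega
  · simp
  · intro i _ hi
    refine Finset.sum_eq_zero fun j _ => ?_
    split_ifs with h
    · have hij : i ≠ j := by rintro rfl; omega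
      rw [columnUnipotent_apply, Matrix.one_apply_ne hij, zero_add]
      split_ifs with h1 h2
      · subst h2; exact absurd (Fin.ext (by simp; omega)) hi
      · rfl
      · rfl
    · rfl
  · simp

/-- The group `GL_c(k) ⋉ k^c`, embedded in the upper left corner: the rows with index at
least `c` and the columns with index greater than `c` are those of the identity matrix. -/
def mirabolic [Finite k] (c : Fin n) : Subgroup (GL (Fin n) k) :=
  subgroupOfFinite
  { carrier := {q | ∀ i j : Fin n, (c ≤ i ∨ c < j) →
      q.val i j = (1 : Matrix (Fin n) (Fin n) k) i j}
    one_mem' := fun _ _ _ => rfl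
    mul_mem' := by
      intro a b ha hb i j hij
      simp only [Set.mem_ofPred_eq] at ha hb
      rw [Units.val_mul, Matrix.mul_apply]
      rcases hij with hi | hj
      · rw [Finset.sum_congr rfl fun m _ => by rw [ha i m (Or.inl hi)], ← Matrix.mul_apply,
          one_mul, hb i j (Or.inl hi)]
      · rw [Finset.sum_congr rfl fun m _ => by rw [hb m j (Or.inr hj)], ← Matrix.mul_apply,
          mul_one, ha i j (Or.inr hj)] }

/-- Conjugating `u` by an element of the mirabolic multiplies `u - 1` by it on the left, if
`u - 1` is supported in columns with index at least `c`. -/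
lemma mirabolic_conj_apply [Finite k] {c : Fin n} {q u : GL (Fin n) k} (hq : q ∈ mirabolic c)
    (hu : ∀ i j : Fin n, j < c → u.val i j = (1 : Matrix (Fin n) (Fin n) k) i j) :
    (q * u * q⁻¹).val = 1 + q.val * (u.val - 1) := by
  -- Only the rows of `q` with index at least `c` meet the support of `u - 1`, and these are rows of
  -- the identity.
  have hX : (u.val - 1) * q.val = u.val - 1 := by
    ext i j
    rw [Matrix.mul_apply]
    have : ∀ m, (u.val - 1) i m * q.val m j =
        (u.val - 1) i m * (1 : Matrix (Fin n) (Fin n) k) m j := by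
      intro m
      by_cases hm : m < c
      · rw [Matrix.sub_apply, hu i m hm, sub_self, zero_mul, zero_mul]
      · rw [hq m j (Or.inl (not_lt.1 hm))]
    rw [Finset.sum_congr rfl fun m _ => this m, ← Matrix.mul_apply, mul_one]
  have hqq : q.val * (q⁻¹).val = 1 := by rw [← Units.val_mul, mul_inv_cancel, Units.val_one]
  have : (q * u).val = (1 + q.val * (u.val - 1)) * q.val := by
    rw [add_mul, mul_assoc, hX, one_mul, Units.val_mul, mul_sub, mul_one, add_sub_cancel]
  rw [Units.val_mul, this, mul_assoc, hqq, mul_one]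

lemma mirabolic_conj_apply_of_le [Finite k] {c : Fin n} {q u : GL (Fin n) k}
    (hq : q ∈ mirabolic c)
    (hu : ∀ i j : Fin n, j < c → u.val i j = (1 : Matrix (Fin n) (Fin n) k) i j)
    {i : Fin n} (hi : c ≤ i) (j : Fin n) : (q * u * q⁻¹).val i j = u.val i j := by
  rw [mirabolic_conj_apply hq hu, Matrix.add_apply, Matrix.mul_apply,
    Finset.sum_congr rfl fun m _ => by rw [hq i m (Or.inl hi)], ← Matrix.mul_apply, one_mul,
    Matrix.sub_apply, add_sub_cancel]

lemma mirabolic_conj_apply_eq_one [Finite k] {c : Fin n} {q u : GL (Fin n) k}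
    (hq : q ∈ mirabolic c)
    (hu : ∀ i j : Fin n, j < c → u.val i j = (1 : Matrix (Fin n) (Fin n) k) i j)
    {j : Fin n} (hj : ∀ i, u.val i j = (1 : Matrix (Fin n) (Fin n) k) i j) (i : Fin n) :
    (q * u * q⁻¹).val i j = (1 : Matrix (Fin n) (Fin n) k) i j := by
  rw [mirabolic_conj_apply hq hu, Matrix.add_apply, Matrix.mul_apply, Finset.sum_eq_zero,
    add_zero]
  intro m _
  rw [Matrix.sub_apply, hj, sub_self, mul_zero]

lemma mirabolic_conj_mem [Finite k] {c : Fin n} {q u : GL (Fin n) k} (hq : q ∈ mirabolic c)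
    (hu : u ∈ unipotentUpper k n (c + 1)) : q * u * q⁻¹ ∈ unipotentUpper k n (c + 1) := by
  have hu' : ∀ i j : Fin n, j < c → u.val i j = (1 : Matrix (Fin n) (Fin n) k) i j :=
    fun i j hj => hu i j (Or.inr (by rw [Fin.lt_def] at hj; omega))
  intro i j hij
  by_cases hj : (j : ℕ) < c + 1
  · exact mirabolic_conj_apply_eq_one hq hu' (fun i => hu i j (Or.inr hj)) i
  · have hji : j ≤ i := hij.resolve_right hj
    rw [mirabolic_conj_apply_of_le hq hu' (by rw [Fin.le_def] at *; omega)]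
    exact hu i j (Or.inl hji)

/-- Conjugation changes only rows before `c`, while the nonzero superdiagonal entries of `u` lie in
columns after `c`, hence in rows from `c` on. Thus the mirabolic stabilizes `ψ` on this group. -/
lemma superdiagSum_mirabolic_conj [Finite k] {c : Fin n} {q u : GL (Fin n) k}
    (hq : q ∈ mirabolic c) (hu : u ∈ unipotentUpper k n (c + 1)) :
    superdiagSum (q * u * q⁻¹) = superdiagSum u := by
  have hu' : ∀ i j : Fin n, j < c → u.val i j = (1 : Matrix (Fin n) (Fin n) k) i j :=
    fun i j hj => hu i j (Or.inr (by rw [Fin.lt_def] at hj; omega))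
  refine Finset.sum_congr rfl fun i _ => Finset.sum_congr rfl fun j _ => ?_
  split_ifs with h
  · by_cases hi : c ≤ i
    · exact mirabolic_conj_apply_of_le hq hu' hi j
    · have hj : (j : ℕ) < c + 1 := by rw [not_le, Fin.lt_def] at hi; omega
      rw [hu i j (Or.inr hj)]
      exact mirabolic_conj_apply_eq_one hq hu' (fun i => hu i j (Or.inr hj)) i
  · rfl

lemma columnUnipotent_mem_mirabolic [Finite k] (c : Fin n) (v : {i : Fin n // i < c} → k) :
    columnUnipotent c (Multiplicative.ofAdd v) ∈ mirabolic c := by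
  intro i j hij
  rw [columnUnipotent_apply]
  split_ifs with h1 h2
  · subst h2; exact absurd hij (by simp [h1])
  · simp
  · simp

/-- The mirabolic acts linearly on the column group `k^c` through its upper left block, and so moves
the characters of that group. -/
lemma mirabolic_conj_columnUnipotent [Finite k] {c : Fin n} {q : GL (Fin n) k}
    (hq : q ∈ mirabolic c) (v : {i : Fin n // i < c} → k) :
    q * columnUnipotent c (Multiplicative.ofAdd v) * q⁻¹ =
      columnUnipotent c (Multiplicative.ofAdd fun i => ∑ m : {m : Fin n // m < c}, q.val i m * v m) := by
  have hu' : ∀ i j : Fin n, j < c → (columnUnipotent c (Multiplicative.ofAdd v)).val i j =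
      (1 : Matrix (Fin n) (Fin n) k) i j :=
    fun i j hj => columnUnipotent_mem c v i j (Or.inr hj)
  ext i j
  by_cases hi : c ≤ i
  · rw [mirabolic_conj_apply_of_le hq hu' hi, columnUnipotent_apply, columnUnipotent_apply,
      dif_neg hi.not_gt, dif_neg hi.not_gt]
  by_cases hj : j = c
  · subst hj
    rw [not_le] at hi
    rw [mirabolic_conj_apply hq hu', columnUnipotent_apply, Matrix.add_apply, dif_pos hi,
      if_pos rfl, Matrix.mul_apply]
    congr 1
    rw [← Finset.sum_filter_of_ne (p := fun m => m < j),
      Finset.sum_subtype (Finset.univ.filter fun m => m < j) (p := fun m => m < j) (by simp)]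
    · refine Finset.sum_congr rfl fun m _ => ?_
      rw [Matrix.sub_apply, columnUnipotent_apply, dif_pos m.2, if_pos rfl, add_sub_cancel_left]
    · intro m _ hm
      by_contra hmj
      apply hm
      rw [Matrix.sub_apply, columnUnipotent_apply, dif_neg hmj, add_zero, sub_self, mul_zero]
  · rw [mirabolic_conj_apply_eq_one hq hu', columnUnipotent_apply]
    · simp [hj]
    · intro i; rw [columnUnipotent_apply]; simp [hj]

end Groups

/-! ### Partial Whittaker spaces and the descent by one column. -/

section Whittaker

variable {k : Type v} [Field k] {n : ℕ}

lemma mul_columnUnipotent_inv_mem [Finite k] {c : Fin n} {u : GL (Fin n) k}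
    (hu : u ∈ unipotentUpper k n c) :
    u * (columnUnipotent c (Multiplicative.ofAdd fun i : {i : Fin n // i < c} => u.val i c))⁻¹ ∈
      unipotentUpper k n (c + 1) := by
  rw [← map_inv, ← ofAdd_neg]
  intro i j hij
  by_cases hjc : j = c
  · subst hjc
    rw [Units.val_mul, Matrix.mul_apply]
    simp only [columnUnipotent_apply, mul_add, Finset.sum_add_distrib]
    rw [← Matrix.mul_apply, mul_one]
    have : ∀ m, (u.val i m * if h : m < j then
        (if True then (-fun i : {i : Fin n // i < j} => u.val i j) ⟨m, h⟩ else 0) else 0) =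
        (1 : Matrix (Fin n) (Fin n) k) i m * if m < j then - u.val m j else 0 := by
      intro m
      by_cases hm : m < j
      · simp only [hm, dite_true, if_true, Pi.neg_apply]
        rw [hu i m (Or.inr hm)]
      · simp [hm]
    rw [Finset.sum_congr rfl fun m _ => this m]
    simp only [Matrix.one_apply, ite_mul, one_mul, zero_mul, Finset.sum_ite_eq, Finset.mem_univ,
      if_true]
    split_ifs with h1 h2 h2
    · exact absurd h2 h1.ne
    · simp
    · rw [hu i j (Or.inl (not_lt.1 h1)), h2]; simp
    · rw [hu i j (Or.inl (not_lt.1 h1)), Matrix.one_apply_ne h2]; simp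
  · have hij' : j ≤ i ∨ (j : ℕ) < c := by
      have := Fin.val_ne_of_ne hjc
      omega
    have hcol : ∀ m, (columnUnipotent c (Multiplicative.ofAdd
        (-fun i : {i : Fin n // i < c} => u.val i c))).val m j =
        (1 : Matrix (Fin n) (Fin n) k) m j := fun m => by
      rw [columnUnipotent_apply]; simp [hjc]
    rw [Units.val_mul, Matrix.mul_apply, Finset.sum_congr rfl fun m _ => by rw [hcol m],
      ← Matrix.mul_apply, mul_one, hu i j hij']

/-- An element of the mirabolic whose row `r < c` is prescribed and nonzero. -/
lemma exists_mirabolic_row [Finite k] {c : Fin n} {y : {i : Fin n // i < c} → k} (hy : y ≠ 0)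
    (r : {i : Fin n // i < c}) :
    ∃ q ∈ mirabolic (k := k) c, (∀ m : {i : Fin n // i < c}, q.val r m = y m) ∧
      ∀ f : k →+* k, (∀ i, f (y i) = y i) → Matrix.GeneralLinearGroup.map f q = q := by
  -- Take the permutation matrix of the transposition of `i₀` and `r` and replace row `r` by `y`.
  -- Expanding `y` in the rows of the permutation matrix gives determinant `± y i₀ ≠ 0`.
  obtain ⟨i₀, hi₀⟩ := Function.ne_iff.1 hy
  let s : Equiv.Perm (Fin n) := Equiv.swap i₀ r
  let A : Matrix (Fin n) (Fin n) k := s.toPEquiv.toMatrix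
  let z : Fin n → k := fun j => if h : j < c then y ⟨j, h⟩ else 0
  let M : Matrix (Fin n) (Fin n) k := A.updateRow r z
  have hA : ∀ i j, A i j = if s i = j then 1 else 0 := by
    intro i j
    simp [A, PEquiv.toMatrix_apply, Equiv.toPEquiv_apply, eq_comm]
  have hz : z = ∑ m, z (s m) • A m := by
    ext j
    simp only [Finset.sum_apply, Pi.smul_apply, hA, smul_eq_mul, mul_ite, mul_one, mul_zero]
    rw [Finset.sum_eq_single (s.symm j)]
    · simp
    · intro m _ hm
      rw [if_neg]
      intro h; exact hm (by simp [← h])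
    · simp
  have hdet : M.det ≠ 0 := by
    have : M.det = z (s r) • A.det := by
      simp only [M]
      rw [← Matrix.det_updateRow_sum A r fun m => z (s m), ← hz]
    rw [this, smul_eq_mul]
    refine mul_ne_zero ?_ ?_
    · have : s r = i₀ := Equiv.swap_apply_right _ _
      simp only [this, z, i₀.2, dite_true]
      exact hi₀
    · simp only [A]
      rw [Matrix.det_permutation]
      rcases Int.units_eq_one_or (Equiv.Perm.sign s) with h | h <;> simp [h]
  have hMr : ∀ j, M r j = z j := fun j => by simp [M]
  have hMi : ∀ i j : Fin n, i ≠ r → M i j = if s i = j then 1 else 0 := fun i j hi => by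
    simp only [M]
    rw [Matrix.updateRow_ne hi, hA]
  have hval : ∀ i j, (Matrix.GeneralLinearGroup.mkOfDetNeZero M hdet).val i j = M i j :=
    fun _ _ => rfl
  refine ⟨Matrix.GeneralLinearGroup.mkOfDetNeZero M hdet, ?_, ?_, ?_⟩
  · intro i j hij
    rw [hval]
    by_cases hi : i = r
    · subst hi
      have hcj : c < j := hij.resolve_left (not_le.2 r.2)
      rw [hMr, Matrix.one_apply_ne (r.2.trans hcj).ne]
      simp [z, hcj.not_gt]
    · rw [hMi i j hi, Matrix.one_apply]
      by_cases hic : c ≤ i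
      · have : s i = i := Equiv.swap_apply_of_ne_of_ne
          (fun h => absurd i₀.2 (by rw [← h]; exact not_lt.2 hic)) hi
        rw [this]
      · have hcj : c < j := hij.resolve_left hic
        rw [not_le] at hic
        have : s i < c := by
          simp only [s, Equiv.swap_apply_def]
          split_ifs
          · exact r.2
          · exact hic
        rw [if_neg (this.trans hcj).ne, if_neg (hic.trans hcj).ne]
  · intro m
    rw [hval, hMr]
    simp [z, m.2]
  -- All entries are 0, 1 or coordinates of `y`, so a ring endomorphism fixing `y` fixes the matrix.
  · intro f hf
    ext i j
    rw [Matrix.GeneralLinearGroup.map_apply, hval]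
    by_cases hi : i = r
    · subst hi
      rw [hMr]
      simp only [z]
      split_ifs
      · exact hf _
      · exact map_zero f
    · rw [hMi i j hi]
      split_ifs
      · exact map_one f
      · exact map_zero f

variable {K : Type*} [Field K] {V : Type u} [AddCommGroup V] [Module K V]
  (ρ : Representation K (GL (Fin n) k) V) (ψ : AddChar k K)

/-- The vectors on which the matrices in `unipotentUpper k n c` act through the character attached
to `ψ`. -/
def whittakerSpace [Finite k] (c : ℕ) : Submodule K V where
  carrier := {x | ∀ u ∈ unipotentUpper k n c, ρ u x = whittakerChar ψ u • x}
  zero_mem' := by simp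
  add_mem' {a b} ha hb u hu := by rw [map_add, ha u hu, hb u hu, smul_add]
  smul_mem' a x hx u hu := by rw [map_smul, hx u hu, smul_comm]

variable {ρ ψ}

lemma mem_whittakerSpace [Finite k] {c : ℕ} {x : V} :
    x ∈ whittakerSpace ρ ψ c ↔ ∀ u ∈ unipotentUpper k n c, ρ u x = whittakerChar ψ u • x :=
  Iff.rfl

lemma mem_whittakerSpace_self [Finite k] (x : V) : x ∈ whittakerSpace ρ ψ n := by
  intro u hu
  rw [eq_one_of_mem_unipotentUpper hu, whittakerChar_one, map_one, one_smul]
  rfl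

lemma whittakerSpace_one [Finite k] : whittakerSpace ρ ψ 1 = whittakerSpace ρ ψ 0 := by
  ext x
  rw [mem_whittakerSpace, mem_whittakerSpace, unipotentUpper_one_eq]

lemma whittakerSpace_mono [Finite k] : Monotone (whittakerSpace ρ ψ) :=
  fun _ _ hcd _ hx u hu => hx u (unipotentUpper_antitone hcd hu)

lemma mirabolic_map_mem [Finite k] {c : Fin n} {q : GL (Fin n) k} (hq : q ∈ mirabolic c) {x : V}
    (hx : x ∈ whittakerSpace ρ ψ (c + 1)) : ρ q x ∈ whittakerSpace ρ ψ (c + 1) := by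
  intro u hu
  have h1 := mirabolic_conj_mem (inv_mem hq) hu
  have h2 := superdiagSum_mirabolic_conj (inv_mem hq) hu
  have h3 : u * q = q * (q⁻¹ * u * q⁻¹⁻¹) := by group
  rw [← Module.End.mul_apply, ← map_mul, h3, map_mul, Module.End.mul_apply, hx _ h1, map_smul,
    whittakerChar, h2]
  rfl

/-- The vectors on which column `c` acts through the character attached to `y`. -/
def IsColumnEigen (ρ : Representation K (GL (Fin n) k) V) (ψ : AddChar k K) {c : Fin n}
    (y : {i : Fin n // i < c} → k) (x : V) : Prop :=
  ∀ v, ρ (columnUnipotent c (Multiplicative.ofAdd v)) x = ψ (∑ i, y i * v i) • x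

lemma IsColumnEigen.apply_eq [Finite k] {c : Fin n} {y : {i : Fin n // i < c} → k} {x : V}
    (hy : IsColumnEigen ρ ψ y x) (hx : x ∈ whittakerSpace ρ ψ (c + 1)) {u : GL (Fin n) k}
    (hu : u ∈ unipotentUpper k n c) :
    ρ u x = (ψ (∑ i : {i : Fin n // i < c}, y i * u.val i c) *
      whittakerChar ψ (u * (columnUnipotent c
        (Multiplicative.ofAdd fun i : {i : Fin n // i < c} => u.val i c))⁻¹)) • x := by
  have h := mul_columnUnipotent_inv_mem hu
  set v := columnUnipotent c (Multiplicative.ofAdd fun i : {i : Fin n // i < c} => u.val i c)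
    with hv
  have h3 : u = (u * v⁻¹) * v := by group
  conv_lhs => rw [h3]
  rw [map_mul, Module.End.mul_apply, hv, hy, map_smul, ← hv, hx _ h, smul_smul]

/-- The index of the row just above the diagonal in column `c`. -/
def aboveDiag {c : Fin n} (hc : 0 < (c : ℕ)) : {i : Fin n // i < c} :=
  ⟨⟨c - 1, by omega⟩, by rw [Fin.lt_def]; simp; omega⟩

lemma whittakerChar_mul_columnUnipotent_inv [Finite k] {c : Fin n} (hc : 0 < (c : ℕ))
    {u : GL (Fin n) k} (hu : u ∈ unipotentUpper k n c) :
    ψ (u.val (aboveDiag hc) c) * whittakerChar ψ (u * (columnUnipotent c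
        (Multiplicative.ofAdd fun i : {i : Fin n // i < c} => u.val i c))⁻¹) =
      whittakerChar ψ u := by
  have h := mul_columnUnipotent_inv_mem hu
  have h2 := columnUnipotent_mem c fun i : {i : Fin n // i < c} => u.val i c
  have h4 := superdiagSum_columnUnipotent hc fun i : {i : Fin n // i < c} => u.val i c
  set v := columnUnipotent c (Multiplicative.ofAdd fun i : {i : Fin n // i < c} => u.val i c)
    with hv
  have h3 : u = (u * v⁻¹) * v := by group
  conv_rhs => rw [h3, whittakerChar_mul ψ (unipotentUpper_antitone (Nat.zero_le _) h)
    (unipotentUpper_antitone (Nat.zero_le _) h2)]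
  rw [mul_comm]
  congr 1
  rw [whittakerChar, h4]
  rfl

/-- Translation by `q` turns the character `y` of the column group into the coordinate vector at `c
- 1`, which is the restriction of `ψ`. It also preserves the condition on the later columns, and the
two subgroups together generate the group for `c`. -/
lemma IsColumnEigen.map_mem [Finite k] {c : Fin n} (hc : 0 < (c : ℕ))
    {y : {i : Fin n // i < c} → k} {x : V}
    (hy : IsColumnEigen ρ ψ y x) (hx : x ∈ whittakerSpace ρ ψ (c + 1)) {q : GL (Fin n) k}
    (hq : q ∈ mirabolic c) (hqy : ∀ m : {i : Fin n // i < c}, q.val (aboveDiag hc) m = y m) :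
    ρ q x ∈ whittakerSpace ρ ψ c := by
  have hqe : IsColumnEigen ρ ψ (Pi.single (aboveDiag hc) 1) (ρ q x) := by
    intro v
    have h1 := mirabolic_conj_columnUnipotent (inv_mem hq) v
    set v' : {i : Fin n // i < c} → k := fun i =>
      ∑ m : {m : Fin n // m < c}, (q⁻¹).val i m * v m with hv'
    have h2 : columnUnipotent c (Multiplicative.ofAdd v) * q =
        q * columnUnipotent c (Multiplicative.ofAdd v') := by
      rw [← h1]; group
    -- Since `v' = q⁻¹ v` and row `c - 1` of `q` is `y`, the sum is coordinate `c - 1` of `q v' =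
    -- v`.
    have h3 : ∑ i, y i * v' i = v (aboveDiag hc) := by
      have h4 := mirabolic_conj_columnUnipotent hq v'
      rw [← h2, mul_assoc, mul_inv_cancel, mul_one] at h4
      have h5 := congrArg (fun g : GL (Fin n) k => g.val (aboveDiag hc) c) h4
      simp only [columnUnipotent_apply, (aboveDiag hc).2, dite_true, if_true] at h5
      rw [add_left_cancel h5]
      exact Finset.sum_congr rfl fun m _ => by rw [hqy]
    rw [← Module.End.mul_apply, ← map_mul, h2, map_mul, Module.End.mul_apply, hy v', map_smul, h3]
    simp [Pi.single_apply]
  intro u hu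
  rw [hqe.apply_eq (mirabolic_map_mem hq hx) hu, ← whittakerChar_mul_columnUnipotent_inv hc hu]
  simp [Pi.single_apply]

/-- The only superdiagonal entry of the radical is at `(c - 1, c)`. Once column `c` is split off,
the remaining factor has trivial `ψ`. -/
lemma IsColumnEigen.apply_eq_self [Finite k] {c : Fin n} (hc : 0 < (c : ℕ)) {x : V}
    (hx0 : IsColumnEigen ρ ψ (0 : {i : Fin n // i < c} → k) x)
    (hx : x ∈ whittakerSpace ρ ψ (c + 1)) {u : GL (Fin n) k}
    (hu : InUnipotentRadical c u) : ρ u x = x := by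
  have huc : u ∈ unipotentUpper k n c := by
    intro i j hij
    refine hu i j ?_
    rw [Fin.le_def] at hij
    omega
  have h := whittakerChar_mul_columnUnipotent_inv (ψ := ψ) hc huc
  have h2 : whittakerChar ψ u = ψ (u.val (aboveDiag hc) c) := by
    rw [whittakerChar, superdiagSum, Finset.sum_eq_single (aboveDiag hc).1,
      Finset.sum_eq_single c, if_pos (by simp [aboveDiag]; omega)]
    · intro j _ hj
      rw [if_neg]
      intro h; apply hj; ext; simp [aboveDiag] at h; omega
    · simp
    · intro i _ hi
      refine Finset.sum_eq_zero fun j _ => ?_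
      split_ifs with h
      · rw [hu i j, Matrix.one_apply_ne]
        · rintro rfl; omega
        · rintro ⟨h3, h4⟩
          exact hi (Fin.ext (by simp [aboveDiag]; omega))
      · rfl
    · simp
  rw [h2] at h
  rw [hx0.apply_eq hx huc, mul_right_eq_self₀.1 h |>.resolve_right (ψ.val_isUnit _).ne_zero]
  simp

end Whittaker

/-! ### Fourier decomposition along a column. -/

section Projection

variable {k : Type v} [Field k] {n : ℕ} [Fintype k]
  {K : Type*} [Field K] {V : Type u} [AddCommGroup V] [Module K V]
  (ρ : Representation K (GL (Fin n) k) V) (ψ : AddChar k K)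

/-- The projection to the vectors on which column `c` acts through the character attached to
`y`. -/
def columnProj {c : Fin n} (y : {i : Fin n // i < c} → k) : Module.End K V :=
  (Fintype.card ({i : Fin n // i < c} → k) : K)⁻¹ •
    ∑ v, ψ (-∑ i, y i * v i) • ρ (columnUnipotent c (Multiplicative.ofAdd v))

lemma columnProj_apply {c : Fin n} (y : {i : Fin n // i < c} → k) (x : V) :
    columnProj ρ ψ y x = (Fintype.card ({i : Fin n // i < c} → k) : K)⁻¹ •
      ∑ v, ψ (-∑ i, y i * v i) • ρ (columnUnipotent c (Multiplicative.ofAdd v)) x := by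
  simp [columnProj]

lemma isColumnEigen_columnProj {c : Fin n} (y : {i : Fin n // i < c} → k) (x : V) :
    IsColumnEigen ρ ψ y (columnProj ρ ψ y x) := by
  intro w
  rw [columnProj_apply, map_smul, smul_comm, map_sum]
  congr 1
  rw [Finset.smul_sum]
  refine Fintype.sum_equiv (Equiv.addLeft w) _ _ fun v => ?_
  rw [map_smul, ← Module.End.mul_apply, ← map_mul, ← map_mul, ← ofAdd_add, smul_smul,
    ← AddChar.map_add_eq_mul, Equiv.coe_addLeft]
  congr 2
  simp [mul_add, Finset.sum_add_distrib]

lemma columnProj_mem {c : Fin n} (y : {i : Fin n // i < c} → k) {x : V}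
    (hx : x ∈ whittakerSpace ρ ψ (c + 1)) :
    columnProj ρ ψ y x ∈ whittakerSpace ρ ψ (c + 1) := by
  rw [columnProj_apply]
  exact Submodule.smul_mem _ _ (Submodule.sum_mem _ fun v _ => Submodule.smul_mem _ _
    (mirabolic_map_mem (columnUnipotent_mem_mirabolic c v) hx))

lemma sum_addChar_dot [DecidableEq k] {ι : Type*} [Fintype ι] [DecidableEq ι]
    (hψ : ψ.IsPrimitive) (v : ι → k) :
    ∑ y : ι → k, ψ (-∑ i, y i * v i) = if v = 0 then (Fintype.card (ι → k) : K) else 0 := by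
  have h1 : ∀ y : ι → k, ψ (-∑ i, y i * v i) = ∏ i, ψ (y i * -v i) := by
    intro y
    rw [← Finset.sum_neg_distrib]
    refine (map_prod ψ.toMonoidHom
      (fun i => Multiplicative.ofAdd (-(y i * v i))) Finset.univ).trans ?_
    exact Finset.prod_congr rfl fun i _ => by rw [mul_neg]; rfl
  simp only [h1]
  rw [← Fintype.piFinset_univ, ← Finset.prod_univ_sum (fun _ => Finset.univ)
    (fun i a => ψ (a * -v i))]
  simp only [AddChar.sum_mulShift _ hψ, neg_eq_zero]
  split_ifs with h
  · subst h; simp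
  · obtain ⟨i, hi⟩ := Function.ne_iff.1 h
    exact Finset.prod_eq_zero (Finset.mem_univ i) 
      (by rw [if_neg (show v i ≠ 0 from hi), Nat.cast_zero])

/-- Fourier inversion on `k^c`: primitivity makes the sum over `y` kill every `v ≠ 0`. -/
lemma sum_columnProj [CharZero K] (hψ : ψ.IsPrimitive) (c : Fin n) (x : V) :
    ∑ y : {i : Fin n // i < c} → k, columnProj ρ ψ y x = x := by
  classical
  simp only [columnProj_apply]
  rw [← Finset.smul_sum, Finset.sum_comm]
  simp only [← Finset.sum_smul, sum_addChar_dot ψ hψ]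
  simp only [ite_smul, zero_smul, Finset.sum_ite_eq', Finset.mem_univ, if_true]
  rw [smul_smul, inv_mul_cancel₀ (Nat.cast_ne_zero.2 Fintype.card_ne_zero), one_smul, ofAdd_zero,
    map_one, map_one]
  rfl

end Projection

/-! ### Cuspidality and existence of Whittaker vectors. -/

section Cuspidal

variable {k : Type v} [Field k] {n : ℕ}

/-- The unipotent radical of `parabolic k n m`. -/
def unipotentRadical (k : Type v) [Field k] [Finite k] (n m : ℕ) : Subgroup (parabolic k n m) :=
  subgroupOfFinite
  { carrier := {p | InUnipotentRadical m (p : GL (Fin n) k)}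
    one_mem' := fun _ _ _ => rfl
    mul_mem' := by
      intro a b ha hb i j hij
      simp only [Set.mem_ofPred_eq, InUnipotentRadical] at ha hb
      rw [Subgroup.coe_mul, Units.val_mul, Matrix.mul_apply]
      by_cases hi : (i : ℕ) < m
      · have hj : ¬ m ≤ (j : ℕ) := fun h => hij ⟨hi, h⟩
        rw [Finset.sum_congr rfl fun t _ => by rw [hb t j fun h => hj h.2], ← Matrix.mul_apply,
          mul_one, ha i j hij]
      · rw [Finset.sum_congr rfl fun t _ => by rw [ha i t fun h => hi h.1], ← Matrix.mul_apply,
          one_mul, hb i j hij] }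

lemma parabolic_apply_eq_zero {m : ℕ} (p : parabolic k n m) {i j : Fin n} (hi : m ≤ (i : ℕ))
    (hj : (j : ℕ) < m) : p.1.val i j = 0 := by
  refine p.2 (?_ : decide (m ≤ (j : ℕ)) < decide (m ≤ (i : ℕ)))
  rw [decide_eq_false (not_le.2 hj), decide_eq_true hi]
  exact Bool.false_lt_true

instance [Finite k] (m : ℕ) : (unipotentRadical k n m).Normal where
  conj_mem := by
    intro u hu p i j hij
    have hpp : p.1.val * (p⁻¹).1.val = 1 := by
      rw [← Units.val_mul, ← Subgroup.coe_mul, mul_inv_cancel]; rfl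
    have h1 : (p * u * p⁻¹).1.val = 1 + p.1.val * (u.1.val - 1) * (p⁻¹).1.val := by
      rw [mul_sub, mul_one, sub_mul, hpp, add_sub_cancel]
      rfl
    rw [h1, Matrix.add_apply]
    refine add_eq_left.2 ?_
    by_cases hi : (i : ℕ) < m
    · have hj : (j : ℕ) < m := not_le.1 fun h => hij ⟨hi, h⟩
      rw [mul_assoc, Matrix.mul_apply]
      refine Finset.sum_eq_zero fun t _ => mul_eq_zero_of_right _ ?_
      rw [Matrix.mul_apply]
      refine Finset.sum_eq_zero fun s _ => ?_
      by_cases hs : m ≤ (s : ℕ)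
      · rw [parabolic_apply_eq_zero _ hs hj, mul_zero]
      · rw [Matrix.sub_apply, hu t s fun h => hs h.2, sub_self, zero_mul]
    · rw [Matrix.mul_apply]
      refine Finset.sum_eq_zero fun t _ => mul_eq_zero_of_left ?_ _
      rw [Matrix.mul_apply]
      refine Finset.sum_eq_zero fun s _ => ?_
      by_cases hs : (s : ℕ) < m
      · rw [parabolic_apply_eq_zero _ (not_lt.1 hi) hs, zero_mul]
      · rw [Matrix.sub_apply, hu s t fun h => hs h.1, sub_self, mul_zero]

variable {K : Type w} [Field K] {V : Type u} [AddCommGroup V] [Module K V]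
  {ρ : Representation K (GL (Fin n) k) V}

/-- A cuspidal representation has no nonzero vectors fixed by the unipotent radical of a maximal
standard parabolic subgroup. -/
lemma IsCuspidal.eq_zero_of_fixed [Finite k] [CharZero K] (hρ : IsCuspidal ρ) {m : ℕ}
    (hm : 1 ≤ m) (hmn : m < n) {x : V}
    (hx : ∀ u : GL (Fin n) k, InUnipotentRadical m u → ρ u x = x) : x = 0 := by
  let P := parabolic k n m
  let S := unipotentRadical k n m
  let ρP : Representation K P V := ρ.comp P.subtype
  let ρS : Representation K S V := ρP.comp S.subtype
  -- Frobenius reciprocity: the quotient to the coinvariants of the radical corresponds to a map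
  -- from `ρ` to the representation induced from them. Its vanishing makes the coinvariants zero.
  let τ := Representation.toCoinvariants ρP S
  have hτ : ∀ p : P, InUnipotentRadical m (p : GL (Fin n) k) → τ p = 1 := by
    intro p hp
    have h : Representation.IsTrivial (τ.comp S.subtype) :=
      inferInstanceAs (Representation.IsTrivial ((Representation.toCoinvariants ρP S).comp S.subtype))
    exact h.out ⟨p, hp⟩
  let f : ρ.IntertwiningMap (Representation.coind P.subtype τ) :=
    { toLinearMap := LinearMap.codRestrict _
        (LinearMap.pi fun g => Representation.Coinvariants.mk ρS ∘ₗ ρ g) (by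
          intro x p g
          simp only [LinearMap.pi_apply, LinearMap.comp_apply, map_mul, Module.End.mul_apply]
          rfl)
      isIntertwining' := by
        intro g
        ext x : 1
        refine Subtype.ext (funext fun h => ?_)
        change Representation.Coinvariants.mk ρS (ρ h (ρ g x)) =
          Representation.Coinvariants.mk ρS (ρ (h * g) x)
        rw [map_mul]; rfl }
  have hf : f = 0 := hρ m hm hmn _ τ hτ f
  have hmk : ∀ x, Representation.Coinvariants.mk ρS x = 0 := by
    intro x
    have h1 := congrArg (fun f : ρ.IntertwiningMap (Representation.coind P.subtype τ) =>
      (f x).1 1) hf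
    have h2 : (f x).1 1 = Representation.Coinvariants.mk ρS (ρ 1 x) := rfl
    rw [map_one] at h2
    exact h2.symm.trans h1
  have : Fintype S := Fintype.ofFinite S
  -- Summation over the radical factors through the coinvariants, but multiplies a fixed vector by
  -- the nonzero order of the radical.
  let A : V →ₗ[K] V := ∑ s : S, ρS s
  have hA : ∀ y ∈ Representation.Coinvariants.ker ρS, A y = 0 := by
    intro y hy
    refine Submodule.span_induction ?_ (map_zero A) ?_ ?_ hy
    · rintro _ ⟨⟨s, z⟩, rfl⟩
      simp only [A, map_sub, LinearMap.sum_apply, ← Module.End.mul_apply, ← map_mul]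
      rw [sub_eq_zero]
      exact Fintype.sum_equiv (Equiv.mulRight s) _ _ fun _ => rfl
    · intro y z _ _ hy hz; rw [map_add, hy, hz, add_zero]
    · intro a y _ hy; rw [map_smul, hy, smul_zero]
  have h1 := hA x ((Representation.Coinvariants.mk_eq_zero _).1 (hmk x))
  have h2 : A x = (Fintype.card S : K) • x := by
    simp only [A, LinearMap.sum_apply]
    have hS : ∀ s : S, ρS s x = x := fun s => hx s.1.1 s.2
    rw [Finset.sum_congr rfl fun s _ => hS s, Finset.sum_const,
      Finset.card_univ, Nat.cast_smul_eq_nsmul]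
  rw [h2] at h1
  exact (smul_eq_zero.1 h1).resolve_left (Nat.cast_ne_zero.2 Fintype.card_ne_zero)

lemma columnProj_zero [Fintype k] [CharZero K] (hρ : IsCuspidal ρ) (ψ : AddChar k K) {c : Fin n}
    (hc : 0 < (c : ℕ)) {x : V} (hx : x ∈ whittakerSpace ρ ψ (c + 1)) :
    columnProj ρ ψ (0 : {i : Fin n // i < c} → k) x = 0 :=
  hρ.eq_zero_of_fixed hc c.2 fun _ hu =>
    (isColumnEigen_columnProj ρ ψ 0 x).apply_eq_self hc (columnProj_mem ρ ψ 0 hx) hu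

/-- A nonzero vector of one stage has a nonzero column component. By cuspidality its character is
nonzero, so the mirabolic moves it to the next stage. -/
lemma whittakerSpace_zero_ne_bot [Fintype k] [CharZero K] [Nontrivial V] (hn : 0 < n)
    (hρ : IsCuspidal ρ) {ψ : AddChar k K} (hψ : ψ.IsPrimitive) :
    whittakerSpace ρ ψ 0 ≠ ⊥ := by
  -- The descent runs from `n` only down to 1; the last condition is vacuous.
  suffices h : ∀ c, c < n → whittakerSpace ρ ψ (n - c) ≠ ⊥ by
    rw [← whittakerSpace_one]
    have := h (n - 1) (by omega)
    rwa [Nat.sub_sub_self (by omega)] at this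
  intro c
  induction c with
  | zero =>
    intro _
    obtain ⟨x, hx⟩ := exists_ne (0 : V)
    exact fun h => hx ((Submodule.mem_bot K).1 (h ▸ mem_whittakerSpace_self x))
  | succ d ih =>
    intro hd
    obtain ⟨x, hx, hx0⟩ := Submodule.exists_mem_ne_zero_of_ne_bot (ih (by omega))
    let c : Fin n := ⟨n - (d + 1), by omega⟩
    have hc : 0 < (c : ℕ) := by simp only [c]; omega
    have hx : x ∈ whittakerSpace ρ ψ (c + 1) := by
      have : (c : ℕ) + 1 = n - d := by simp only [c]; omega
      rwa [this]
    obtain ⟨y, hy⟩ : ∃ y : {i : Fin n // i < c} → k, columnProj ρ ψ y x ≠ 0 := by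
      by_contra! h
      apply hx0
      rw [← sum_columnProj ρ ψ hψ c x]
      exact Finset.sum_eq_zero fun y _ => h y
    have hy0 : y ≠ 0 := by
      rintro rfl
      exact hy (columnProj_zero hρ ψ hc hx)
    obtain ⟨q, hq, hqy, -⟩ := exists_mirabolic_row hy0 (aboveDiag hc)
    have hmem := (isColumnEigen_columnProj ρ ψ y x).map_mem hc (columnProj_mem ρ ψ y hx) hq hqy
    intro h
    rw [show n - (d + 1) = (c : ℕ) from rfl] at h
    rw [h, Submodule.mem_bot] at hmem
    apply hy
    have := congrArg (ρ q⁻¹) hmem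
    rwa [← Module.End.mul_apply, ← map_mul, inv_mul_cancel, map_one, map_zero] at this

end Cuspidal

/-! ### Reflection in the antidiagonal. -/

section Flip

variable {k : Type v} [Field k] {n : ℕ}

/-- The reflection of a matrix in the antidiagonal, an anti-automorphism of `GL_n(k)`. -/
def flipGL (g : GL (Fin n) k) : GL (Fin n) k where
  val := Matrix.of fun i j => g.val j.rev i.rev
  inv := Matrix.of fun i j => (g⁻¹).val j.rev i.rev
  val_inv := by
    have h : (g⁻¹).val * g.val = 1 := by rw [← Units.val_mul, inv_mul_cancel, Units.val_one]
    ext i j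
    have h' := congrFun (congrFun h j.rev) i.rev
    rw [Matrix.mul_apply] at h' ⊢
    simp only [Matrix.of_apply]
    rw [← Equiv.sum_comp Fin.revPerm] at h'
    simp only [Fin.revPerm_apply] at h'
    rw [Finset.sum_congr rfl fun m _ => mul_comm _ _, h', Matrix.one_apply, Matrix.one_apply]
    simp [eq_comm]
  inv_val := by
    have h : g.val * (g⁻¹).val = 1 := by rw [← Units.val_mul, mul_inv_cancel, Units.val_one]
    ext i j
    have h' := congrFun (congrFun h j.rev) i.rev
    rw [Matrix.mul_apply] at h' ⊢
    simp only [Matrix.of_apply]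
    rw [← Equiv.sum_comp Fin.revPerm] at h'
    simp only [Fin.revPerm_apply] at h'
    rw [Finset.sum_congr rfl fun m _ => mul_comm _ _, h', Matrix.one_apply, Matrix.one_apply]
    simp [eq_comm]

lemma flipGL_apply (g : GL (Fin n) k) (i j : Fin n) : (flipGL g).val i j = g.val j.rev i.rev := rfl

lemma flipGL_flipGL (g : GL (Fin n) k) : flipGL (flipGL g) = g := by
  ext i j
  rw [flipGL_apply, flipGL_apply, Fin.rev_rev, Fin.rev_rev]

lemma flipGL_mul (g h : GL (Fin n) k) : flipGL (g * h) = flipGL h * flipGL g := by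
  ext i j
  rw [flipGL_apply, Units.val_mul, Units.val_mul, Matrix.mul_apply, Matrix.mul_apply,
    ← Equiv.sum_comp Fin.revPerm]
  exact Finset.sum_congr rfl fun m _ => mul_comm _ _

lemma flipGL_mem [Finite k] {u : GL (Fin n) k} (hu : u ∈ unipotentUpper k n 0) :
    flipGL u ∈ unipotentUpper k n 0 := by
  intro i j hij
  have hij : j ≤ i := by simpa using hij
  rw [flipGL_apply, hu _ _ (Or.inl (Fin.rev_le_rev.2 hij)), Matrix.one_apply, Matrix.one_apply]
  simp [eq_comm]

lemma superdiagSum_flipGL (u : GL (Fin n) k) : superdiagSum (flipGL u) = superdiagSum u := by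
  rw [superdiagSum, superdiagSum, Finset.sum_comm, ← Equiv.sum_comp Fin.revPerm]
  refine Finset.sum_congr rfl fun i _ => ?_
  rw [← Equiv.sum_comp Fin.revPerm]
  refine Finset.sum_congr rfl fun j _ => ?_
  simp only [Fin.revPerm_apply, flipGL_apply, Fin.rev_rev, Fin.val_rev]
  congr 1
  rw [eq_iff_iff]
  omega

lemma whittakerChar_flipGL {K : Type*} [Field K] {ψ : AddChar k K} (u : GL (Fin n) k) :
    whittakerChar ψ (flipGL u) = whittakerChar ψ u := by
  rw [whittakerChar, superdiagSum_flipGL]; rfl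

lemma columnUnipotent_mul_apply {c : Fin n} (v : {i : Fin n // i < c} → k) (g : GL (Fin n) k)
    (i j : Fin n) :
    (columnUnipotent c (Multiplicative.ofAdd v) * g).val i j =
      g.val i j + if h : i < c then v ⟨i, h⟩ * g.val c j else 0 := by
  rw [Units.val_mul, Matrix.mul_apply]
  simp only [columnUnipotent_apply, add_mul, Finset.sum_add_distrib]
  congr 1
  · rw [← Matrix.mul_apply, one_mul]
  · by_cases h : i < c
    · simp [h]
    · simp [h]

lemma mul_columnUnipotent_apply {c : Fin n} (v : {i : Fin n // i < c} → k) (g : GL (Fin n) k)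
    (i j : Fin n) :
    (g * columnUnipotent c (Multiplicative.ofAdd v)).val i j =
      g.val i j + if j = c then ∑ m : {i : Fin n // i < c}, g.val i m * v m else 0 := by
  rw [Units.val_mul, Matrix.mul_apply]
  simp only [columnUnipotent_apply, mul_add, Finset.sum_add_distrib]
  congr 1
  · rw [← Matrix.mul_apply, mul_one]
  · split_ifs with h
    · rw [← Finset.sum_filter_of_ne (p := fun m => m < c),
        Finset.sum_subtype (Finset.univ.filter fun m => m < c) (p := fun m => m < c) (by simp)]
      · exact Finset.sum_congr rfl fun m _ => by rw [dif_pos m.2]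
      · intro m _ hm
        by_contra hmj
        exact hm (by rw [dif_neg hmj, mul_zero])
    · simp

/-- The flip turns row operations into column operations: multiples of column `c` are added to later
columns. -/
lemma mul_flipGL_columnUnipotent_apply {c : Fin n} (v : {i : Fin n // i < c.rev} → k)
    (g : GL (Fin n) k) (i j : Fin n) :
    (g * flipGL (columnUnipotent c.rev (Multiplicative.ofAdd v))).val i j =
      g.val i j + if h : c < j then v ⟨j.rev, Fin.rev_lt_rev.2 h⟩ * g.val i c else 0 := by
  rw [← flipGL_flipGL g, ← flipGL_mul, flipGL_apply, columnUnipotent_mul_apply, flipGL_flipGL]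
  simp only [flipGL_apply, Fin.rev_rev, Fin.rev_lt_rev]

end Flip

/-! ### Bruhat decomposition by elimination. -/

section Bruhat

variable {k : Type v} [Field k] {n : ℕ}

/-- A matrix with at most one nonzero entry in each row and column. -/
def IsMonomial (g : GL (Fin n) k) : Prop :=
  ∃ p : Equiv.Perm (Fin n), ∀ i j, j ≠ p i → g.val i j = 0

lemma IsMonomial.flipGL {g : GL (Fin n) k} (hg : IsMonomial g) : IsMonomial (flipGL g) := by
  obtain ⟨p, hp⟩ := hg
  refine ⟨Fin.revPerm.trans (p.symm.trans Fin.revPerm), fun i j hij => ?_⟩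
  rw [flipGL_apply]
  refine hp _ _ fun h => hij ?_
  simp [h]

lemma exists_apply_ne_zero (g : GL (Fin n) k) (i : Fin n) : ∃ j, g.val i j ≠ 0 := by
  by_contra! h
  have h1 : g.val * (g⁻¹).val = 1 := by rw [← Units.val_mul, mul_inv_cancel, Units.val_one]
  have h2 := congrFun (congrFun h1 i) i
  rw [Matrix.mul_apply, Matrix.one_apply_eq, Finset.sum_eq_zero] at h2
  · exact zero_ne_one h2
  · intro j _; rw [h, zero_mul]

/-- The rows of `g` with index at least `r` have only one nonzero entry, which is also the only one
in its column. -/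
def ReducedFrom (r : ℕ) (g : GL (Fin n) k) : Prop :=
  ∀ i : Fin n, r ≤ i → ∃ j, g.val i j ≠ 0 ∧ (∀ j', j' ≠ j → g.val i j' = 0) ∧
    ∀ i', i' ≠ i → g.val i' j = 0

/-- The pivot is the leftmost nonzero entry of row `r`, so only upward row operations and rightward
column operations are needed. The rows below already vanish in the pivot column, since their own
nonzero entries are alone in their columns. -/
lemma ReducedFrom.step [Finite k] {r : Fin n} {g : GL (Fin n) k} (hg : ReducedFrom (r + 1) g) :
    ∃ a ∈ unipotentUpper k n 0, ∃ b ∈ unipotentUpper k n 0, ReducedFrom r (a * g * b) := by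
  classical
  have hex : (Finset.univ.filter fun j => g.val r j ≠ 0).Nonempty := by
    obtain ⟨j, hj⟩ := exists_apply_ne_zero g r
    exact ⟨j, by simp [hj]⟩
  let j := Finset.min' _ hex
  have hj : g.val r j ≠ 0 := by
    have := Finset.min'_mem _ hex
    rw [Finset.mem_filter] at this
    exact this.2
  have hmin : ∀ m, m < j → g.val r m = 0 := by
    intro m hm
    by_contra h
    exact absurd (Finset.min'_le _ m (by simp [h])) (not_le.2 hm)
  -- `a` clears the pivot column above row `r`; `b` clears row `r` to the right of the pivot.
  let a := columnUnipotent r (Multiplicative.ofAdd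
    fun i : {i : Fin n // i < r} => - g.val i j / g.val r j)
  let b := flipGL (columnUnipotent j.rev (Multiplicative.ofAdd
    fun m : {m : Fin n // m < j.rev} => - g.val r m.1.rev / g.val r j))
  have ha : ∀ i m, (a * g).val i m =
      g.val i m + if i < r then - g.val i j / g.val r j * g.val r m else 0 := by
    intro i m
    rw [columnUnipotent_mul_apply]
    simp
  have hcol : ∀ i, i ≠ r → (a * g).val i j = 0 := by
    intro i hi
    rw [ha]
    split_ifs with h
    · field_simp; ring
    · obtain ⟨j₀, h0, h1, h2⟩ := hg i (by
        have := lt_of_le_of_ne (not_lt.1 h) (Ne.symm hi)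
        rw [Fin.lt_def] at this; omega)
      rw [add_zero]
      refine h1 j ?_
      intro hjj
      exact hj (hjj ▸ h2 r (Ne.symm hi))
  have hrow : ∀ m, (a * g).val r m = g.val r m := by
    intro m; rw [ha, if_neg (lt_irrefl r), add_zero]
  have hb : ∀ i m, (a * g * b).val i m = (a * g).val i m +
      if j < m then - g.val r m / g.val r j * (a * g).val i j else 0 := by
    intro i m
    rw [mul_flipGL_columnUnipotent_apply]
    simp
  have hb1 : ∀ i m, i ≠ r → (a * g * b).val i m = (a * g).val i m := by
    intro i m hi
    rw [hb, hcol i hi]; simp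
  have hb2 : ∀ m, m ≠ j → (a * g * b).val r m = 0 := by
    intro m hm
    rw [hb, hrow, hrow]
    split_ifs with h
    · field_simp; ring
    · rw [hmin m (lt_of_le_of_ne (not_lt.1 h) hm), add_zero]
  refine ⟨a, unipotentUpper_antitone (Nat.zero_le _) (columnUnipotent_mem _ _), b,
    flipGL_mem (unipotentUpper_antitone (Nat.zero_le _) (columnUnipotent_mem _ _)), ?_⟩
  intro i hi
  by_cases hir : i = r
  · subst hir
    refine ⟨j, ?_, hb2, ?_⟩
    · rw [hb, hrow, if_neg (lt_irrefl j), add_zero]; exact hj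
    · intro i' hi'
      rw [hb1 i' j hi', hcol i' hi']
  · have hri : (r : ℕ) + 1 ≤ i := by have := Fin.val_ne_of_ne hir; omega
    obtain ⟨j₀, h0, h1, h2⟩ := hg i hri
    have hag : ∀ m, (a * g).val i m = g.val i m := by
      intro m; rw [ha, if_neg, add_zero]
      rw [Fin.lt_def]; omega
    have hjj : j₀ ≠ j := by
      rintro rfl
      exact hj (h2 r (Ne.symm hir))
    refine ⟨j₀, ?_, ?_, ?_⟩
    · rwa [hb1 i _ hir, hag]
    · intro j' hj'
      rw [hb1 i _ hir, hag, h1 j' hj']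
    · intro i' hi'
      by_cases hi'r : i' = r
      · subst hi'r; exact hb2 _ hjj
      · rw [hb1 _ _ hi'r, ha, h2 i' hi', h2 r (Ne.symm hir)]
        simp

/-- Every double coset of the group of upper triangular unipotent matrices contains a monomial
matrix. -/
lemma exists_isMonomial [Finite k] (g : GL (Fin n) k) :
    ∃ a ∈ unipotentUpper k n 0, ∃ b ∈ unipotentUpper k n 0, IsMonomial (a * g * b) := by
  have h : ∀ d, d ≤ n → ∃ a ∈ unipotentUpper k n 0, ∃ b ∈ unipotentUpper k n 0,
      ReducedFrom (n - d) (a * g * b) := by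
    intro d
    induction d with
    | zero => exact fun _ => ⟨1, one_mem _, 1, one_mem _, fun i hi => absurd i.2 (by omega)⟩
    | succ d ih =>
      intro hd
      obtain ⟨a, ha, b, hb, hab⟩ := ih (by omega)
      obtain ⟨a', ha', b', hb', hab'⟩ := ReducedFrom.step (r := ⟨n - (d + 1), by omega⟩)
        (g := a * g * b) (by
          have : n - (d + 1) + 1 = n - d := by omega
          simpa only [this] using hab)
      refine ⟨a' * a, mul_mem ha' ha, b * b', mul_mem hb hb', ?_⟩
      have : a' * a * g * (b * b') = a' * (a * g * b) * b' := by group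
      rw [this]
      exact hab'
  obtain ⟨a, ha, b, hb, hab⟩ := h n le_rfl
  refine ⟨a, ha, b, hb, ?_⟩
  choose p hp0 hp1 hp2 using fun i : Fin n => hab i (by omega)
  have hinj : Function.Injective p := by
    intro i i' hii
    by_contra hne
    apply hp0 i
    rw [hii]
    exact hp2 i' i hne
  exact ⟨Equiv.ofBijective p (Finite.injective_iff_bijective.1 hinj), fun i j hij => hp1 i j hij⟩

end Bruhat

/-! ### Combinatorics of permutations whose ascents are all by one. -/

section Blocks

variable {n : ℕ} {f : ℕ → ℕ}

/-- The first descent after `i` must avoid the values already taken by the run from `f i`, hence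
falls below `f i`. A later ascent by one could only return to `f i` itself, which injectivity
forbids. -/
lemma eq_add_or_lt_of_step (hinj : Set.InjOn f (Set.Iio n))
    (hstep : ∀ i, i + 1 < n → f (i + 1) = f i + 1 ∨ f (i + 1) < f i) (i d : ℕ) (hd : i + d < n) :
    ((∀ m, i ≤ m → m < i + d → f (m + 1) = f m + 1) ∧ ∀ e ≤ d, f (i + e) = f i + e) ∨
      ((∃ m, i ≤ m ∧ m < i + d ∧ f (m + 1) ≠ f m + 1) ∧ f (i + d) < f i) := by
  induction d with
  | zero => exact Or.inl ⟨fun m h1 h2 => absurd h1 (by omega), fun e he => by simp_all⟩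
  | succ d ih =>
    rcases ih (by omega) with ⟨h1, h2⟩ | ⟨⟨m, hm1, hm2, hm3⟩, h2⟩
    · rcases hstep (i + d) (by omega) with h | h
      · left
        refine ⟨fun m hm1 hm2 => ?_, fun e he => ?_⟩
        · rcases Nat.lt_or_ge m (i + d) with h' | h'
          · exact h1 m hm1 h'
          · obtain rfl : m = i + d := by omega
            exact h
        · rcases Nat.lt_or_ge d e with h' | h'
          · obtain rfl : e = d + 1 := by omega
            have := h2 d le_rfl
            rw [← add_assoc, h, this, add_assoc]
          · exact h2 e h'
      · right
        refine ⟨⟨i + d, by omega, by omega, by omega⟩, ?_⟩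
        by_contra hlt
        have hd' := h2 d le_rfl
        rw [← add_assoc] at hlt
        have he := h2 (f (i + d + 1) - f i) (by omega)
        rw [Nat.add_sub_cancel' (by omega)] at he
        have := hinj (by simp only [Set.mem_Iio]; omega) (by simp only [Set.mem_Iio]; omega) he
        omega
    · right
      refine ⟨⟨m, hm1, by omega, hm3⟩, ?_⟩
      rcases hstep (i + d) (by omega) with h | h
      · refine lt_of_le_of_ne (by rw [← add_assoc, h]; omega) fun he => ?_
        have := hinj (by simp only [Set.mem_Iio]; omega) (by simp only [Set.mem_Iio]; omega) he
        omega
      · rw [← add_assoc]; omega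

/-- A permutation of `{0, …, n - 1}` whose only ascents are by one reverses the order of the
intervals on which it is increasing. -/
lemma exists_block (hmaps : ∀ i, i < n → f i < n) (hinj : Set.InjOn f (Set.Iio n))
    (hstep : ∀ i, i + 1 < n → f (i + 1) = f i + 1 ∨ f (i + 1) < f i) {i : ℕ} (hi : i < n) :
    ∃ a b, a ≤ i ∧ i ≤ b ∧ b < n ∧ (∀ m, a ≤ m → m < b → f (m + 1) = f m + 1) ∧
      ∀ m, a ≤ m → m ≤ b → f m + b + 1 = n + (m - a) := by
  have hb : ∀ d i, i + d + 1 = n → ∃ b, i ≤ b ∧ b < n ∧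
      (∀ m, i ≤ m → m < b → f (m + 1) = f m + 1) ∧ (b + 1 < n → f (b + 1) ≠ f b + 1) := by
    intro d
    induction d with
    | zero => exact fun i h => ⟨i, le_rfl, by omega, fun m h1 h2 => absurd h1 (by omega), by omega⟩
    | succ d ih =>
      intro i h
      by_cases hs : f (i + 1) = f i + 1
      · obtain ⟨b, h1, h2, h3, h4⟩ := ih (i + 1) (by omega)
        refine ⟨b, by omega, h2, fun m hm1 hm2 => ?_, h4⟩
        rcases Nat.lt_or_ge i m with h' | h'
        · exact h3 m h' hm2
        · obtain rfl : m = i := by omega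
          exact hs
      · exact ⟨i, le_rfl, by omega, fun m h1 h2 => absurd h1 (by omega), fun _ => hs⟩
  have ha : ∀ i, ∃ a, a ≤ i ∧ (∀ m, a ≤ m → m < i → f (m + 1) = f m + 1) ∧
      (∀ a', a' + 1 = a → f (a' + 1) ≠ f a' + 1) := by
    intro i
    induction i with
    | zero => exact ⟨0, le_rfl, fun m h1 h2 => absurd h2 (by omega), fun a' h => absurd h (by omega)⟩
    | succ i ih =>
      by_cases hs : f (i + 1) = f i + 1
      · obtain ⟨a, h1, h2, h3⟩ := ih
        refine ⟨a, by omega, fun m hm1 hm2 => ?_, h3⟩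
        rcases Nat.lt_or_ge m i with h' | h'
        · exact h2 m hm1 h'
        · obtain rfl : m = i := by omega
          exact hs
      · refine ⟨i + 1, le_rfl, fun m h1 h2 => absurd h1 (by omega), fun a' h => ?_⟩
        obtain rfl : a' = i := by omega
        exact hs
  obtain ⟨b, hib, hbn, hb1, hb2⟩ := hb (n - 1 - i) i (by omega)
  obtain ⟨a, hai, ha1, ha2⟩ := ha i
  have hab : ∀ m, a ≤ m → m < b → f (m + 1) = f m + 1 := fun m h1 h2 => by
    rcases Nat.lt_or_ge m i with h' | h'
    · exact ha1 m h1 h'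
    · exact hb1 m h' h2
  have hblock : ∀ e ≤ b - a, f (a + e) = f a + e := by
    rcases eq_add_or_lt_of_step hinj hstep a (b - a) (by omega) with h | ⟨⟨m, h1, h2, h3⟩, -⟩
    · exact h.2
    · exact absurd (hab m h1 (by omega)) h3
  -- For the maximal run `[a, b]` through `i`, the values below `f a` are those taken after `b`.
  -- Counting them gives `f a = n - b - 1`.
  have hlt : ∀ j, j < n → (f j < f a ↔ b < j) := by
    intro j hj
    rcases Nat.lt_or_ge b j with h | h
    · refine iff_of_true ?_ h
      rcases eq_add_or_lt_of_step hinj hstep a (j - a) (by omega) with h' | ⟨-, h'⟩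
      · exact absurd (h'.1 b (by omega) (by omega)) (hb2 (by omega))
      · rwa [Nat.add_sub_cancel' (by omega)] at h'
    · refine iff_of_false ?_ (not_lt.2 h)
      rcases Nat.lt_or_ge j a with h' | h'
      · rcases eq_add_or_lt_of_step hinj hstep j (a - j) (by omega) with h'' | ⟨-, h''⟩
        · exact absurd (by
            have := h''.1 (a - 1) (by omega) (by omega)
            simpa using this) (ha2 (a - 1) (by omega))
        · rw [Nat.add_sub_cancel' (by omega)] at h''; omega
      · have := hblock (j - a) (by omega)
        rw [Nat.add_sub_cancel' h'] at this; omega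
  have himage : (Finset.range n).image f = Finset.range n := by
    refine Finset.eq_of_subset_of_card_le ?_ ?_
    · intro x hx
      obtain ⟨j, hj, rfl⟩ := Finset.mem_image.1 hx
      exact Finset.mem_range.2 (hmaps j (Finset.mem_range.1 hj))
    · rw [Finset.card_image_of_injOn]
      simpa using hinj
  have hcard : (Finset.Ioo b n).image f = Finset.range (f a) := by
    ext x
    simp only [Finset.mem_image, Finset.mem_Ioo, Finset.mem_range]
    constructor
    · rintro ⟨j, ⟨h1, h2⟩, rfl⟩
      exact (hlt j h2).2 h1
    · intro hx
      have hxn : x ∈ (Finset.range n).image f := by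
        rw [himage, Finset.mem_range]
        exact hx.trans (hmaps a (by omega))
      obtain ⟨j, hj, rfl⟩ := Finset.mem_image.1 hxn
      rw [Finset.mem_range] at hj
      exact ⟨j, ⟨(hlt j hj).1 hx, hj⟩, rfl⟩
  have hfa : f a = n - b - 1 := by
    rw [← Finset.card_range (f a), ← hcard, Finset.card_image_of_injOn, Nat.card_Ioo]
    exact hinj.mono fun j hj => by
      simp only [Finset.coe_Ioo, Set.mem_Ioo] at hj
      exact hj.2
  refine ⟨a, b, hai, hib, hbn, hab, fun m h1 h2 => ?_⟩
  have := hblock (m - a) (by omega)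
  rw [Nat.add_sub_cancel' h1] at this
  omega

end Blocks

/-! ### Generation of irreducible representations by orbits. -/

section Irreducible

variable {G K V : Type*} [Group G] [Field K] [AddCommGroup V] [Module K V]
  {ρ : Representation K G V}

/-- An irreducible representation is spanned by the orbit of a nonzero subspace. -/
lemma iSup_map_eq_top (hρ : ρ.IsIrreducible) {F : Submodule K V} (hF : F ≠ ⊥) :
    ⨆ g, F.map (ρ g) = ⊤ := by
  let S : Subrepresentation ρ :=
    { toSubmodule := ⨆ g, F.map (ρ g)
      apply_mem_toSubmodule := by
        intro h x hx
        refine Submodule.iSup_induction _ (motive := fun x => ρ h x ∈ ⨆ g, F.map (ρ g)) hx ?_ ?_ ?_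
        · rintro g _ ⟨y, hy, rfl⟩
          rw [← Module.End.mul_apply, ← map_mul]
          exact Submodule.mem_iSup_of_mem (h * g) ⟨y, hy, rfl⟩
        · rw [map_zero]; exact zero_mem _
        · intro x y hx hy; rw [map_add]; exact add_mem hx hy }
  have hle : F ≤ S.toSubmodule := fun x hx =>
    Submodule.mem_iSup_of_mem 1 ⟨x, hx, by rw [map_one]; rfl⟩
  rcases hρ.eq_bot_or_eq_top S with h | h
  · exfalso
    apply hF
    rw [eq_bot_iff]
    have : S.toSubmodule = ⊥ := by rw [h]; rfl
    rwa [this] at hle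
  · have : S.toSubmodule = ⊤ := by rw [h]; rfl
    exact this

/-- Linear maps from an irreducible representation that agree on the orbit of a nonzero vector are
equal. -/
lemma eq_of_eq_on_orbit (hρ : ρ.IsIrreducible) {x : V} (hx : x ≠ 0)
    {A B : Module.End K V} (h : ∀ g, A (ρ g x) = B (ρ g x)) : A = B := by
  have hle : ⨆ g, (K ∙ x).map (ρ g) ≤ LinearMap.eqLocus A B := by
    refine iSup_le fun g => ?_
    rintro _ ⟨y, hy, rfl⟩
    obtain ⟨a, rfl⟩ := Submodule.mem_span_singleton.1 hy
    simp only [LinearMap.mem_eqLocus, map_smul, h]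
  rw [iSup_map_eq_top hρ (by rwa [Ne, Submodule.span_singleton_eq_bot])] at hle
  exact LinearMap.ext fun z => hle (x := z) trivial

end Irreducible

/-! ### Gelfand–Graev argument: uniqueness of Whittaker vectors. -/

section MultiplicityOne

variable {k : Type v} [Field k] {n : ℕ} [Finite k]
  {K : Type*} [Field K] {V : Type u} [AddCommGroup V] [Module K V]
  (ρ : Representation K (GL (Fin n) k) V) (ψ : AddChar k K)

/-- The projection to the space of Whittaker vectors. -/
def whittakerProj : Module.End K V :=
  (Nat.card (unipotentUpper k n 0) : K)⁻¹ •
    ∑ᶠ u : unipotentUpper k n 0, whittakerChar ψ (u : GL (Fin n) k)⁻¹ • ρ u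

variable {ρ ψ}

lemma whittakerChar_inv {u : GL (Fin n) k} (hu : u ∈ unipotentUpper k n 0) :
    whittakerChar ψ u⁻¹ = (whittakerChar ψ u)⁻¹ := by
  refine eq_inv_of_mul_eq_one_left ?_
  rw [← whittakerChar_mul ψ (inv_mem hu) hu, inv_mul_cancel, whittakerChar_one]

lemma map_mul_whittakerProj {u : GL (Fin n) k} (hu : u ∈ unipotentUpper k n 0) :
    ρ u * whittakerProj ρ ψ = whittakerChar ψ u • whittakerProj ρ ψ := by
  have : Fintype (unipotentUpper k n 0) := Fintype.ofFinite _
  rw [whittakerProj, mul_smul_comm, smul_comm, finsum_eq_sum_of_fintype]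
  congr 1
  rw [Finset.mul_sum, Finset.smul_sum]
  refine Fintype.sum_equiv (Equiv.mulLeft ⟨u, hu⟩) _ _ fun a => ?_
  rw [mul_smul_comm, ← map_mul, smul_smul, Equiv.coe_mulLeft, Subgroup.coe_mul, mul_inv_rev,
    whittakerChar_mul ψ (inv_mem a.2) (inv_mem hu), mul_left_comm, whittakerChar_inv hu,
    mul_inv_cancel₀ (whittakerChar_ne_zero ψ u), mul_one]

lemma whittakerProj_mul_map {u : GL (Fin n) k} (hu : u ∈ unipotentUpper k n 0) :
    whittakerProj ρ ψ * ρ u = whittakerChar ψ u • whittakerProj ρ ψ := by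
  have : Fintype (unipotentUpper k n 0) := Fintype.ofFinite _
  rw [whittakerProj, smul_mul_assoc, smul_comm, finsum_eq_sum_of_fintype]
  congr 1
  rw [Finset.sum_mul, Finset.smul_sum]
  refine Fintype.sum_equiv (Equiv.mulRight ⟨u, hu⟩) _ _ fun a => ?_
  rw [smul_mul_assoc, ← map_mul, smul_smul, Equiv.coe_mulRight, Subgroup.coe_mul, mul_inv_rev,
    whittakerChar_mul ψ (inv_mem hu) (inv_mem a.2), whittakerChar_inv hu,
    mul_inv_cancel_left₀ (whittakerChar_ne_zero ψ u)]

lemma whittakerProj_mem (x : V) : whittakerProj ρ ψ x ∈ whittakerSpace ρ ψ 0 := fun u hu => by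
  rw [← Module.End.mul_apply, map_mul_whittakerProj hu, LinearMap.smul_apply]

lemma average_whittakerChar_smul [CharZero K] [Fintype (unipotentUpper k n 0)] {M : Type*}
    [AddCommGroup M] [Module K M] (F : GL (Fin n) k → M) (m : M)
    (hF : ∀ u ∈ unipotentUpper k n 0, F u = whittakerChar ψ u • m) :
    (Nat.card (unipotentUpper k n 0) : K)⁻¹ •
      ∑ u : unipotentUpper k n 0, whittakerChar ψ (u : GL (Fin n) k)⁻¹ • F u = m := by
  have h : ∀ u : unipotentUpper k n 0, whittakerChar ψ (u : GL (Fin n) k)⁻¹ • F u = m := fun u => by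
    rw [hF u u.2, smul_smul, whittakerChar_inv u.2, inv_mul_cancel₀ (whittakerChar_ne_zero ψ _),
      one_smul]
  rw [Finset.sum_congr rfl fun u _ => h u, Finset.sum_const, Finset.card_univ,
    ← Nat.cast_smul_eq_nsmul K, smul_smul, Nat.card_eq_fintype_card,
    inv_mul_cancel₀ (Nat.cast_ne_zero.2 Fintype.card_ne_zero), one_smul]

lemma whittakerProj_apply_of_mem [CharZero K] {x : V} (hx : x ∈ whittakerSpace ρ ψ 0) :
    whittakerProj ρ ψ x = x := by
  have : Fintype (unipotentUpper k n 0) := Fintype.ofFinite _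
  rw [whittakerProj, finsum_eq_sum_of_fintype, LinearMap.smul_apply, LinearMap.sum_apply]
  exact average_whittakerChar_smul (fun u => ρ u x) x hx

lemma whittakerProj_mul_self [CharZero K] :
    whittakerProj ρ ψ * whittakerProj ρ ψ = whittakerProj ρ ψ :=
  LinearMap.ext fun x => whittakerProj_apply_of_mem (whittakerProj_mem x)

variable (ρ ψ) in
/-- The Hecke operator of a group element on Whittaker vectors. -/
def heckeOp (g : GL (Fin n) k) : Module.End K V :=
  whittakerProj ρ ψ * ρ g * whittakerProj ρ ψ

lemma heckeOp_mul_left {u : GL (Fin n) k} (hu : u ∈ unipotentUpper k n 0) (g : GL (Fin n) k) :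
    heckeOp ρ ψ (u * g) = whittakerChar ψ u • heckeOp ρ ψ g := by
  rw [heckeOp, map_mul, ← mul_assoc, whittakerProj_mul_map hu, smul_mul_assoc, smul_mul_assoc]; rfl

lemma heckeOp_mul_right {u : GL (Fin n) k} (hu : u ∈ unipotentUpper k n 0) (g : GL (Fin n) k) :
    heckeOp ρ ψ (g * u) = whittakerChar ψ u • heckeOp ρ ψ g := by
  rw [heckeOp, map_mul, mul_assoc, mul_assoc, map_mul_whittakerProj hu, mul_smul_comm,
    mul_smul_comm, ← mul_assoc]; rfl

lemma heckeOp_mul_heckeOp [CharZero K] (g h : GL (Fin n) k) :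
    heckeOp ρ ψ g * heckeOp ρ ψ h = (Nat.card (unipotentUpper k n 0) : K)⁻¹ •
      ∑ᶠ u : unipotentUpper k n 0,
        whittakerChar ψ (u : GL (Fin n) k)⁻¹ • heckeOp ρ ψ (g * u * h) := by
  have : Fintype (unipotentUpper k n 0) := Fintype.ofFinite _
  have h1 : heckeOp ρ ψ g * heckeOp ρ ψ h =
      whittakerProj ρ ψ * ρ g * whittakerProj ρ ψ * (ρ h * whittakerProj ρ ψ) := by
    rw [heckeOp, heckeOp, mul_assoc (whittakerProj ρ ψ) (ρ h), ← mul_assoc _ (whittakerProj ρ ψ),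
      mul_assoc _ _ (whittakerProj ρ ψ), whittakerProj_mul_self]
  have h2 : ∀ X Y : Module.End K V, X * whittakerProj ρ ψ * Y =
      (Nat.card (unipotentUpper k n 0) : K)⁻¹ • ∑ u : unipotentUpper k n 0,
        whittakerChar ψ (u : GL (Fin n) k)⁻¹ • (X * ρ u * Y) := by
    intro X Y
    rw [whittakerProj, finsum_eq_sum_of_fintype, mul_smul_comm, smul_mul_assoc, Finset.mul_sum,
      Finset.sum_mul]
    simp only [mul_smul_comm, smul_mul_assoc]
  rw [h1, h2, finsum_eq_sum_of_fintype]
  simp only [heckeOp, map_mul, mul_assoc]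

/-- A monomial matrix with nonzero Hecke operator is symmetric about the antidiagonal. -/
lemma flipGL_eq_of_isMonomial (hψ : ψ.IsPrimitive) {g : GL (Fin n) k} (hg : IsMonomial g)
    (hne : heckeOp ρ ψ g ≠ 0) : flipGL g = g := by
  obtain ⟨p, hp⟩ := hg
  have hs0 : ∀ i, g.val i (p i) ≠ 0 := by
    intro i
    obtain ⟨j, hj⟩ := exists_apply_ne_zero g i
    by_cases h : j = p i
    · rwa [h] at hj
    · exact absurd (hp i j h) hj
  -- Conjugation by `g` carries the root subgroup at `(p i, p m)` to the one at `(i, m)`, rescaling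
  -- the parameter by a ratio of entries of `g`.
  have hconj : ∀ (i m : Fin n) (him : i < m) (hpim : p i < p m) (z : k),
      g * columnUnipotent (p m) (Multiplicative.ofAdd (Pi.single ⟨p i, hpim⟩ z)) =
        columnUnipotent m (Multiplicative.ofAdd
          (Pi.single ⟨i, him⟩ (g.val i (p i) * z / g.val m (p m)))) * g := by
    intro i m him hpim z
    ext a b
    rw [mul_columnUnipotent_apply, columnUnipotent_mul_apply]
    congr 1
    have h1 : ∑ t : {t : Fin n // t < p m}, g.val a t * (Pi.single ⟨p i, hpim⟩ z :
        {t : Fin n // t < p m} → k) t = g.val a (p i) * z := by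
      rw [Finset.sum_eq_single ⟨p i, hpim⟩]
      · simp
      · intro t _ ht; simp [ht]
      · simp
    rw [h1]
    by_cases hb : b = p m
    · subst hb
      rw [if_pos rfl]
      by_cases ha : a = i
      · subst ha
        rw [dif_pos him, Pi.single_eq_same, div_mul_cancel₀ _ (hs0 m)]
      · rw [hp a (p i) (fun h => ha (p.injective h).symm), zero_mul]
        split_ifs with h
        · rw [Pi.single_eq_of_ne (by simpa using ha), zero_mul]
        · rfl
    · rw [if_neg hb, hp m b hb]
      simp
  -- Moving a root element across `g` evaluates the nonzero Hecke operator in two ways, so the two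
  -- character values agree. The position `(i, m)` is superdiagonal; `(p i, p m)` is so only for an
  -- ascent by one.
  have hchar : ∀ (i m : Fin n) (him : (m : ℕ) = i + 1) (hpim : p i < p m) (z : k),
      ψ (if (p m : ℕ) = p i + 1 then z else 0) = ψ (g.val i (p i) * z / g.val m (p m)) := by
    intro i m him hpim z
    have h1 := congrArg (heckeOp ρ ψ) (hconj i m (by rw [Fin.lt_def]; omega) hpim z)
    rw [heckeOp_mul_right (unipotentUpper_antitone (Nat.zero_le _) (columnUnipotent_mem _ _)),
      heckeOp_mul_left (unipotentUpper_antitone (Nat.zero_le _) (columnUnipotent_mem _ _))] at h1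
    have h2 := smul_left_injective K hne h1
    rw [Fin.lt_def] at hpim
    rw [whittakerChar, whittakerChar, superdiagSum_columnUnipotent (by omega),
      superdiagSum_columnUnipotent (by omega), Pi.single_apply, Pi.single_apply] at h2
    have him' : (⟨(m : ℕ) - 1, by omega⟩ : Fin n) = i := Fin.ext (by simp; omega)
    simp only [him', if_true] at h2
    rw [← h2]
    congr 2
    simp only [Subtype.mk.injEq, Fin.ext_iff, eq_iff_iff]
    omega
  have hasc : ∀ (i m : Fin n), (m : ℕ) = i + 1 → p i < p m →
      (p m : ℕ) = p i + 1 ∧ g.val i (p i) = g.val m (p m) := by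
    intro i m him hpim
    have h := hchar i m him hpim
    by_cases hpm : (p m : ℕ) = p i + 1
    · refine ⟨hpm, ?_⟩
      simp only [hpm, if_true] at h
      by_contra hne
      have h0 : g.val i (p i) / g.val m (p m) - 1 ≠ 0 := by
        rw [sub_ne_zero]
        intro h'
        exact hne ((div_eq_one_iff_eq (hs0 m)).1 h')
      apply hψ h0
      ext z
      rw [AddChar.mulShift_apply, sub_mul, one_mul, AddChar.map_sub_eq_div, h z, div_mul_eq_mul_div,
        div_self ((ψ.val_isUnit _).ne_zero)]
      rfl
    · simp only [hpm, if_false, AddChar.map_zero_eq_one] at h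
      exfalso
      apply hψ (div_ne_zero (hs0 i) (hs0 m))
      ext z
      rw [AddChar.mulShift_apply, div_mul_eq_mul_div, ← h z]
      rfl
  let f : ℕ → ℕ := fun i => if h : i < n then p ⟨i, h⟩ else 0
  have hf : ∀ i : Fin n, f i = p i := fun i => by simp [f]
  have hf' : ∀ {i : ℕ} (h : i < n), f i = p ⟨i, h⟩ := fun h => hf ⟨_, h⟩
  -- By `exists_block`, `p` maps the run `[a, b]` onto `[n - 1 - b, n - 1 - a]` in increasing order,
  -- so `(p i).rev = a + b - i` lies in the same run. The entries are constant along a run.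
  have hsym : ∀ i : Fin n, p (p i).rev = i.rev ∧ g.val (p i).rev (p (p i).rev) = g.val i (p i) := by
    intro i
    obtain ⟨a, b, hai, hib, hbn, hab, hval⟩ := exists_block (f := f) (n := n)
      (fun i hi => by rw [hf' hi]; exact (p ⟨i, hi⟩).2)
      (fun i hi j hj hij => by
        rw [Set.mem_Iio] at hi hj
        rw [hf' hi, hf' hj] at hij
        have := p.injective (Fin.ext hij)
        simpa using this)
      (fun i hi => by
        rw [hf' hi, hf' (Nat.lt_of_succ_lt hi)]
        have hne : p ⟨i, Nat.lt_of_succ_lt hi⟩ ≠ p ⟨i + 1, hi⟩ := fun h => by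
          have := p.injective h
          simp at this
        rcases lt_or_gt_of_ne hne with h | h
        · exact Or.inl (hasc _ _ rfl h).1
        · exact Or.inr h) i.2
    have hpi := hval i hai hib
    rw [hf] at hpi
    have hrev : ((p i).rev : ℕ) = a + b - i := by rw [Fin.val_rev]; omega
    have hprev := hval (p i).rev (by omega) (by omega)
    rw [hf] at hprev
    refine ⟨Fin.ext (by rw [Fin.val_rev]; omega), ?_⟩
    have hconst : ∀ d (m : Fin n), (m : ℕ) = a + d → (m : ℕ) ≤ b →
        g.val m (p m) = g.val ⟨a, by omega⟩ (p ⟨a, by omega⟩) := by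
      intro d
      induction d with
      | zero =>
        intro m hm _
        have : m = ⟨a, by omega⟩ := Fin.ext hm
        rw [this]
      | succ d ih =>
        intro m hm hmb
        have hd : a + d < n := by omega
        rw [← ih ⟨a + d, hd⟩ rfl (by simp; omega)]
        refine (hasc ⟨a + d, hd⟩ m (by simp; omega) ?_).2.symm
        have h1 := hab (a + d) (by omega) (by omega)
        rw [hf' hd, show a + d + 1 = (m : ℕ) by omega, hf] at h1
        rw [Fin.lt_def]; omega
    rw [hconst ((p i).rev - a) _ (by omega) (by omega), hconst (i - a) i (by omega) hib]
  ext i j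
  rw [flipGL_apply]
  by_cases hj : j = p i
  · subst hj
    rw [← (hsym i).2, (hsym i).1]
  · rw [hp i j hj]
    refine hp _ _ fun h => hj ?_
    rw [← (hsym i).1] at h
    exact (Fin.rev_injective (p.injective h)).symm

/-- Both sides transform by the same characters under unipotent factors, so a monomial
representative suffices. There, either the matrix is its own flip or both operators vanish. -/
lemma heckeOp_flipGL (hψ : ψ.IsPrimitive) (g : GL (Fin n) k) :
    heckeOp ρ ψ (flipGL g) = heckeOp ρ ψ g := by
  obtain ⟨a, ha, b, hb, hm⟩ := exists_isMonomial g
  have key : heckeOp ρ ψ (flipGL (a * g * b)) = heckeOp ρ ψ (a * g * b) := by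
    by_cases h1 : heckeOp ρ ψ (a * g * b) = 0
    · by_cases h2 : heckeOp ρ ψ (flipGL (a * g * b)) = 0
      · rw [h1, h2]
      · have := flipGL_eq_of_isMonomial hψ hm.flipGL h2
        rw [flipGL_flipGL] at this
        rw [← this]
    · rw [flipGL_eq_of_isMonomial hψ hm h1]
  rw [flipGL_mul, flipGL_mul, heckeOp_mul_left (flipGL_mem hb), heckeOp_mul_right (flipGL_mem ha),
    heckeOp_mul_right hb, heckeOp_mul_left ha, whittakerChar_flipGL, whittakerChar_flipGL] at key
  exact smul_right_injective _ (whittakerChar_ne_zero ψ a)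
    (smul_right_injective _ (whittakerChar_ne_zero ψ b) key)

/-- The Hecke algebra of the Whittaker character is commutative. -/
lemma heckeOp_comm [CharZero K] (hψ : ψ.IsPrimitive) (g h : GL (Fin n) k) :
    heckeOp ρ ψ g * heckeOp ρ ψ h = heckeOp ρ ψ h * heckeOp ρ ψ g := by
  have : Fintype (unipotentUpper k n 0) := Fintype.ofFinite _
  rw [← heckeOp_flipGL hψ h, ← heckeOp_flipGL hψ g, heckeOp_mul_heckeOp (flipGL h) (flipGL g),
    heckeOp_flipGL hψ h, heckeOp_flipGL hψ g, heckeOp_mul_heckeOp g h]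
  congr 1
  rw [finsum_eq_sum_of_fintype, finsum_eq_sum_of_fintype]
  refine Fintype.sum_equiv (⟨fun u => ⟨flipGL u, flipGL_mem u.2⟩, fun u => ⟨flipGL u, flipGL_mem u.2⟩,
    fun u => Subtype.ext (flipGL_flipGL _), fun u => Subtype.ext (flipGL_flipGL _)⟩ :
      unipotentUpper k n 0 ≃ unipotentUpper k n 0) _ _ fun u => ?_
  rw [Equiv.coe_fn_mk, whittakerChar_inv u.2, whittakerChar_inv (flipGL_mem u.2),
    whittakerChar_flipGL, ← heckeOp_flipGL hψ (g * u.1 * h), flipGL_mul, flipGL_mul, mul_assoc]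

lemma heckeOp_mem (g : GL (Fin n) k) (x : V) : heckeOp ρ ψ g x ∈ whittakerSpace ρ ψ 0 :=
  whittakerProj_mem _

/-- The translates of `F` span `V`, and the Whittaker projection sends the translate by `g` to the
image of `F` under `heckeOp ρ ψ g`. So the Whittaker vectors are irreducible under Hecke operators.
-/
lemma eq_whittakerSpace_of_stable [CharZero K] (hρ : ρ.IsIrreducible) {F : Submodule K V}
    (hF : F ≠ ⊥) (hle : F ≤ whittakerSpace ρ ψ 0) (hst : ∀ g, ∀ x ∈ F, heckeOp ρ ψ g x ∈ F) :
    F = whittakerSpace ρ ψ 0 := by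
  refine le_antisymm hle fun x hx => ?_
  have h : ∀ z ∈ ⨆ g, F.map (ρ g), whittakerProj ρ ψ z ∈ F := by
    intro z hz
    refine Submodule.iSup_induction _ (motive := fun x => whittakerProj ρ ψ x ∈ F) hz ?_ ?_ ?_
    · rintro g _ ⟨y, hy, rfl⟩
      have := hst g y hy
      rwa [heckeOp, Module.End.mul_apply, whittakerProj_apply_of_mem (hle hy)] at this
    · rw [map_zero]; exact zero_mem _
    · intro x y hx hy; rw [map_add]; exact add_mem hx hy
  rw [← whittakerProj_apply_of_mem hx]
  exact h x (by rw [iSup_map_eq_top hρ hF]; trivial)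

/-- Uniqueness of Whittaker models. -/
lemma whittakerSpace_eq_span [CharZero K] [IsAlgClosed K] [FiniteDimensional K V]
    (hψ : ψ.IsPrimitive) (hρ : ρ.IsIrreducible) {x : V} (hx : x ∈ whittakerSpace ρ ψ 0)
    (hx0 : x ≠ 0) : whittakerSpace ρ ψ 0 = K ∙ x := by
  -- Schur's argument: by commutativity an eigenspace of one Hecke operator is stable under all the
  -- others, hence is everything.
  have hscalar : ∀ g, ∃ a : K, ∀ y ∈ whittakerSpace ρ ψ 0, heckeOp ρ ψ g y = a • y := by
    intro g
    let A : Module.End K (whittakerSpace ρ ψ 0) :=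
      (heckeOp ρ ψ g).restrict fun y _ => heckeOp_mem g y
    have : Nontrivial (whittakerSpace ρ ψ 0) :=
      ⟨⟨⟨x, hx⟩, 0, fun h => hx0 (congrArg Subtype.val h)⟩⟩
    obtain ⟨a, ha⟩ := Module.End.exists_eigenvalue A
    obtain ⟨y, hy⟩ := ha.exists_hasEigenvector
    let F : Submodule K V := whittakerSpace ρ ψ 0 ⊓ Module.End.eigenspace (heckeOp ρ ψ g) a
    have hF : F = whittakerSpace ρ ψ 0 := by
      refine eq_whittakerSpace_of_stable hρ ?_ inf_le_left ?_
      · intro hbot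
        apply hy.2
        have hyF : (y : V) ∈ F :=
          ⟨y.2, Module.End.mem_eigenspace_iff.2 (congrArg Subtype.val hy.apply_eq_smul)⟩
        rw [hbot, Submodule.mem_bot] at hyF
        exact Subtype.ext hyF
      · rintro h z ⟨hz1, hz2⟩
        refine ⟨heckeOp_mem h z, Module.End.mem_eigenspace_iff.2 ?_⟩
        rw [← Module.End.mul_apply, heckeOp_comm hψ, Module.End.mul_apply,
          Module.End.mem_eigenspace_iff.1 hz2, map_smul]
    exact ⟨a, fun z hz => Module.End.mem_eigenspace_iff.1 (hF.symm ▸ hz : z ∈ F).2⟩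
  refine (eq_whittakerSpace_of_stable hρ ?_ ?_ ?_).symm
  · rwa [Ne, Submodule.span_singleton_eq_bot]
  · rwa [Submodule.span_singleton_le_iff_mem]
  · intro g y hy
    obtain ⟨a, ha⟩ := hscalar g
    rw [ha y ((Submodule.span_singleton_le_iff_mem _ _).2 hx hy)]
    exact Submodule.smul_mem _ _ hy

end MultiplicityOne

/-! ### Vanishing of Tate cohomology on free orbits. -/

section TateOrbits

variable {R : Type*} [CommRing R] {V : Type*} [AddCommGroup V] [Module R V]

lemma tateNorm_apply (l : ℕ) (T : Module.End R V) (x : V) :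
    tateNorm l T x = ∑ i ∈ Finset.range l, (T ^ i) x := by
  simp [tateNorm]

/-- If `T` permutes the terms of a decomposition of `M` through a map of prime order `l`, then the
first Tate cohomology of `M` comes from the terms that are mapped to themselves. -/
lemma mem_map_one_sub_of_decomposition {l : ℕ} (hl : l.Prime) {T : Module.End R V}
    {M : Submodule R V} (hTM : ∀ x ∈ M, T x ∈ M) {Y : Type*} [Fintype Y]
    {φ : Y → Y} (hφ : ∀ y, φ^[l] y = y) (P : Y → Module.End R V)
    (hsum : ∀ x, ∑ y, P y x = x) (hPM : ∀ y, ∀ x ∈ M, P y x ∈ M)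
    (hTP : ∀ y x, T (P y x) = P (φ y) (T x)) {x : V} (hx : x ∈ M) (hNx : tateNorm l T x = 0)
    (hfix : ∀ y, φ y = y → P y x ∈ M.map (1 - T)) : x ∈ M.map (1 - T) := by
  classical
  have hTM' : ∀ i : ℕ, ∀ x ∈ M, (T ^ i) x ∈ M := by
    intro i
    induction i with
    | zero => exact fun x hx => hx
    | succ i ih => intro x hx; rw [pow_succ']; exact hTM _ (ih x hx)
  have hsub : ∀ i : ℕ, ∀ x ∈ M, x - (T ^ i) x ∈ M.map (1 - T) := by
    intro i
    induction i with
    | zero => intro x _; rw [pow_zero, Module.End.one_apply, sub_self]; exact zero_mem _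
    | succ i ih =>
      intro x hx
      have h1 : (1 - T) ((T ^ i) x) ∈ M.map (1 - T) := ⟨_, hTM' i x hx, rfl⟩
      have h2 := add_mem (ih x hx) h1
      rwa [LinearMap.sub_apply, Module.End.one_apply, sub_add_sub_cancel, ← Module.End.mul_apply,
        ← pow_succ'] at h2
  have hTPi : ∀ (i : ℕ) y x, (T ^ i) (P y x) = P (φ^[i] y) ((T ^ i) x) := by
    intro i
    induction i with
    | zero => intro y x; rfl
    | succ i ih =>
      intro y x
      rw [pow_succ', Module.End.mul_apply, ih, hTP, Function.iterate_succ_apply']; rfl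
  -- Modulo the image of `1 - T`, the term at `φ^[i] y` may be replaced by its image under `T ^ (l -
  -- i)`, which lies in component `y`. The sum then becomes `P y (T (tateNorm l T x)) = 0`.
  have horbit : ∀ y, ∑ i ∈ Finset.range l, P (φ^[i] y) x ∈ M.map (1 - T) := by
    intro y
    have h1 : ∑ i ∈ Finset.range l, (T ^ (l - i)) (P (φ^[i] y) x) = 0 := by
      have h2 : ∀ i ∈ Finset.range l, (T ^ (l - i)) (P (φ^[i] y) x) =
          P y ((T ^ (l - i)) x) := by
        intro i hi
        rw [hTPi, ← Function.iterate_add_apply, Nat.sub_add_cancel (Finset.mem_range.1 hi).le, hφ]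
      rw [Finset.sum_congr rfl h2, ← map_sum]
      have h3 : ∑ i ∈ Finset.range l, (T ^ (l - i)) x = T (tateNorm l T x) := by
        rw [tateNorm_apply, map_sum, ← Finset.sum_range_reflect]
        refine Finset.sum_congr rfl fun i hi => ?_
        rw [Finset.mem_range] at hi
        rw [show l - (l - 1 - i) = i + 1 by omega, pow_succ']
        rfl
      rw [h3, hNx, map_zero, map_zero]
    rw [← sub_zero (∑ i ∈ Finset.range l, _), ← h1, ← Finset.sum_sub_distrib]
    exact Submodule.sum_mem _ fun i _ => hsub _ _ (hPM _ x hx)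
  have key : ∀ (m : ℕ) (S : Finset Y), S.card = m → (∀ y ∈ S, φ y ∈ S) →
      ∑ y ∈ S, P y x ∈ M.map (1 - T) := by
    intro m
    induction m using Nat.strong_induction_on with
    | _ m ih =>
    intro S hS hφS
    rcases S.eq_empty_or_nonempty with rfl | ⟨y, hy⟩
    · rw [Finset.sum_empty]; exact zero_mem _
    have hSi : ∀ i : ℕ, φ^[i] y ∈ S := by
      intro i
      induction i with
      | zero => exact hy
      | succ i ih => rw [Function.iterate_succ_apply']; exact hφS _ ih
    let O : Finset Y := (Finset.range l).image fun i => φ^[i] y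
    have hOS : O ⊆ S := by
      intro z hz
      obtain ⟨i, -, rfl⟩ := Finset.mem_image.1 hz
      exact hSi i
    have hyO : y ∈ O := Finset.mem_image.2 ⟨0, Finset.mem_range.2 hl.pos, rfl⟩
    have hO : ∀ i : ℕ, φ^[i] y ∈ O := fun i => by
      refine Finset.mem_image.2 ⟨i % l, Finset.mem_range.2 (Nat.mod_lt _ hl.pos), ?_⟩
      exact Function.IsPeriodicPt.iterate_mod_apply (hφ y) i
    have hrest : ∑ z ∈ S \ O, P z x ∈ M.map (1 - T) := by
      refine ih _ ?_ (S \ O) rfl ?_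
      · rw [← hS]
        exact Finset.card_lt_card ⟨Finset.sdiff_subset, fun h =>
          (Finset.mem_sdiff.1 (h hy)).2 hyO⟩
      · intro z hz
        rw [Finset.mem_sdiff] at hz ⊢
        refine ⟨hφS z hz.1, fun hzO => hz.2 ?_⟩
        obtain ⟨i, -, hi⟩ := Finset.mem_image.1 hzO
        have h1 : z = φ^[l - 1 + i] y := by
          rw [Function.iterate_add_apply]
          rw [hi, ← Function.iterate_succ_apply, Nat.succ_eq_add_one,
            Nat.sub_add_cancel hl.one_le, hφ]
        rw [h1]
        exact hO _
    have hsumO : ∑ z ∈ O, P z x ∈ M.map (1 - T) := by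
      by_cases hfy : φ y = y
      · have hOy : O = {y} := by
          ext z
          simp only [O, Finset.mem_image, Finset.mem_range, Finset.mem_singleton]
          constructor
          · rintro ⟨i, -, rfl⟩
            exact Function.iterate_fixed hfy i
          · rintro rfl
            exact ⟨0, hl.pos, rfl⟩
        rw [hOy, Finset.sum_singleton]
        exact hfix y hfy
      -- Primality of `l` leaves no orbit length strictly between 1 and `l`.
      · have hper : Function.minimalPeriod φ y = l := by
          rcases (Nat.dvd_prime hl).1 (Function.IsPeriodicPt.minimalPeriod_dvd (hφ y)) with h | h
          · exact absurd (Function.minimalPeriod_eq_one_iff_isFixedPt.1 h) hfy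
          · exact h
        simp only [O]
        rw [Finset.sum_image]
        · exact horbit y
        · have := Function.iterate_injOn_Iio_minimalPeriod (f := φ) (x := y)
          rw [hper] at this
          simpa using this
    rw [← Finset.sum_sdiff hOS]
    exact add_mem hrest hsumO
  rw [← hsum x]
  exact key _ Finset.univ rfl fun _ _ => Finset.mem_univ _

end TateOrbits

/-! ### Frobenius, the trace character and intertwining operators. -/

section TraceChar

variable {k' : Type w} [Field k'] {K : Type*} [Field K]

/-- The additive character of `k` obtained from one of `k'` by composition with the trace. -/
def traceChar (k : Type v) [Field k] [Algebra k' k] (ε : AddChar k' K) : AddChar k K :=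
  ε.compAddMonoidHom (Algebra.trace k' k).toAddMonoidHom

lemma traceChar_apply {k : Type v} [Field k] [Algebra k' k] (ε : AddChar k' K) (x : k) :
    traceChar k ε x = ε (Algebra.trace k' k x) := rfl

end TraceChar

section Frobenius

variable {k' : Type w} [Field k'] [Fintype k'] {k : Type v} [Field k] [Algebra k' k] {n : ℕ}

lemma frobGL_apply (g : GL (Fin n) k) (i j : Fin n) :
    (frobGL k' k n g).val i j = FiniteField.frobeniusAlgHom k' k (g.val i j) := rfl

lemma frobenius_iterate_finrank [FiniteDimensional k' k] (x : k) :
    (FiniteField.frobeniusAlgHom k' k)^[Module.finrank k' k] x = x := by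
  have : Finite k := Module.finite_of_finite k'
  have h := pow_orderOf_eq_one (FiniteField.frobeniusAlgHom k' k)
  rw [FiniteField.orderOf_frobeniusAlgHom] at h
  rw [← AlgHom.coe_pow, h]; rfl

lemma frobGL_iterate_finrank [FiniteDimensional k' k] (g : GL (Fin n) k) :
    (frobGL k' k n)^[Module.finrank k' k] g = g := by
  have h : ∀ (d : ℕ) (g : GL (Fin n) k) (i j : Fin n), ((frobGL k' k n)^[d] g).val i j =
      (FiniteField.frobeniusAlgHom k' k)^[d] (g.val i j) := by
    intro d
    induction d with
    | zero => intro g i j; rfl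
    | succ d ih => intro g i j; rw [Function.iterate_succ_apply, ih]; rfl
  ext i j
  rw [h, frobenius_iterate_finrank]

lemma trace_frobenius [FiniteDimensional k' k] (x : k) :
    Algebra.trace k' k (FiniteField.frobeniusAlgHom k' k x) = Algebra.trace k' k x :=
  Algebra.trace_eq_of_algEquiv (FiniteField.frobeniusAlgEquivOfAlgebraic k' k) x

lemma frobGL_mem [Finite k] {c : ℕ} {u : GL (Fin n) k} (hu : u ∈ unipotentUpper k n c) :
    frobGL k' k n u ∈ unipotentUpper k n c := by
  intro i j hij
  rw [frobGL_apply, hu i j hij, Matrix.one_apply]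
  split_ifs
  · exact map_one _
  · exact map_zero _

lemma superdiagSum_frobGL (g : GL (Fin n) k) :
    superdiagSum (frobGL k' k n g) = FiniteField.frobeniusAlgHom k' k (superdiagSum g) := by
  simp only [superdiagSum, map_sum]
  refine Finset.sum_congr rfl fun i _ => Finset.sum_congr rfl fun j _ => ?_
  split_ifs
  · rfl
  · exact (map_zero _).symm

lemma frobGL_columnUnipotent {c : Fin n} (v : {i : Fin n // i < c} → k) :
    frobGL k' k n (columnUnipotent c (Multiplicative.ofAdd v)) =
      columnUnipotent c (Multiplicative.ofAdd fun i => FiniteField.frobeniusAlgHom k' k (v i)) := by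
  ext i j
  rw [frobGL_apply, columnUnipotent_apply, columnUnipotent_apply, map_add]
  congr 1
  · rw [Matrix.one_apply]
    split_ifs
    · exact map_one _
    · exact map_zero _
  · split_ifs
    · rfl
    · exact map_zero _
    · exact map_zero _

variable {K : Type*} [Field K]

lemma traceChar_isPrimitive [FiniteDimensional k' k] {ε : AddChar k' K} (hε : ε ≠ 1) :
    (traceChar k ε).IsPrimitive := by
  refine AddChar.IsPrimitive.of_ne_one fun h => hε ?_
  ext x
  obtain ⟨y, rfl⟩ := Algebra.trace_surjective k' k x
  rw [← traceChar_apply, h]; rfl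

variable {V : Type u} [AddCommGroup V] [Module K V] {ρ : Representation K (GL (Fin n) k) V}
  {ε : AddChar k' K} {T : Module.End K V}

lemma whittakerChar_frobGL [FiniteDimensional k' k] (g : GL (Fin n) k) :
    whittakerChar (traceChar k ε) (frobGL k' k n g) = whittakerChar (traceChar k ε) g := by
  rw [whittakerChar, superdiagSum_frobGL, traceChar_apply, trace_frobenius]; rfl

lemma map_pow_map (hT : ∀ g x, T (ρ g x) = ρ (frobGL k' k n g) (T x)) (d : ℕ) (g : GL (Fin n) k) (x : V) :
    (T ^ d) (ρ g x) = ρ ((frobGL k' k n)^[d] g) ((T ^ d) x) := by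
  induction d with
  | zero => rfl
  | succ d ih =>
    rw [pow_succ', Module.End.mul_apply, ih, hT, Function.iterate_succ_apply']; rfl

lemma map_mem_whittakerSpace [FiniteDimensional k' k] [Finite k]
    (hT : ∀ g x, T (ρ g x) = ρ (frobGL k' k n g) (T x)) {c : ℕ} {x : V}
    (hx : x ∈ whittakerSpace ρ (traceChar k ε) c) : T x ∈ whittakerSpace ρ (traceChar k ε) c := by
  intro u hu
  have hmem : ∀ d : ℕ, (frobGL k' k n)^[d] u ∈ unipotentUpper k n c := by
    intro d
    induction d with
    | zero => exact hu
    | succ d ih => rw [Function.iterate_succ_apply']; exact frobGL_mem ih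
  have h := frobGL_iterate_finrank (k' := k') u
  have hpos : 0 < Module.finrank k' k := Module.finrank_pos
  -- Since Frobenius has finite order, `u` is the Frobenius image of an earlier iterate of itself,
  -- so the intertwining relation applies to `ρ u`.
  rw [show Module.finrank k' k = (Module.finrank k' k - 1) + 1 by omega,
    Function.iterate_succ_apply'] at h
  conv_lhs => rw [← h]
  rw [← hT, hx _ (hmem _), map_smul, ← whittakerChar_frobGL (k' := k'), h]

/-- Reindex the average by Frobenius; the trace pairing is unchanged when both arguments are
twisted. -/
lemma map_columnProj [FiniteDimensional k' k] [Fintype k]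
    (hT : ∀ g x, T (ρ g x) = ρ (frobGL k' k n g) (T x)) {c : Fin n}
    (y : {i : Fin n // i < c} → k) (x : V) :
    T (columnProj ρ (traceChar k ε) y x) =
      columnProj ρ (traceChar k ε) (fun i => FiniteField.frobeniusAlgHom k' k (y i)) (T x) := by
  rw [columnProj_apply, columnProj_apply, map_smul, map_sum]
  congr 1
  have hinj : Function.Injective
      fun (v : {i : Fin n // i < c} → k) i => FiniteField.frobeniusAlgHom k' k (v i) :=
    (RingHom.injective (FiniteField.frobeniusAlgHom k' k : k →+* k)).comp_left
  refine Fintype.sum_bijective _ (Finite.injective_iff_bijective.1 hinj) _ _ fun v => ?_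
  rw [map_smul, hT, frobGL_columnUnipotent]
  congr 1
  rw [traceChar_apply, traceChar_apply, ← trace_frobenius]
  simp only [map_neg, map_sum, map_mul]

end Frobenius

/-! ### The normalized Frobenius operator. -/

section Existence

variable {l : ℕ} [Fact l.Prime] {k' : Type w} [Field k'] [Fintype k']
  {k : Type v} [Field k] [Algebra k' k] [Finite k] {n : ℕ}
  {V : Type u} [AddCommGroup V] [Module (QlBar l) V]
  {ρ : Representation (QlBar l) (GL (Fin n) k) V} {ε : AddChar k' (QlBar l)}

lemma IsFrobOperator.apply_of_mem {T : Module.End (QlBar l) V} (hT : IsFrobOperator ρ ε T) {x : V}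
    (hx : x ∈ whittakerSpace ρ (traceChar k ε) 0) : T x = x :=
  hT.normalized x fun u hu => hx u (mem_unipotentUpper_zero.2 hu)

/-- There is exactly one normalized Frobenius operator. -/
lemma existsUnique_isFrobOperator [FiniteDimensional k' k] [FiniteDimensional (QlBar l) V]
    (hdeg : Module.finrank k' k = l) (hn : 0 < n)
    (hirr : ρ.IsIrreducible) (hcusp : IsCuspidal ρ) (hfix : IsFrobFixed k' ρ) (hε : ε ≠ 1) :
    ∃! T : Module.End (QlBar l) V, IsFrobOperator ρ ε T := by
  have : Fintype k := Fintype.ofFinite k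
  have hψ := traceChar_isPrimitive (k := k) hε
  have : Nontrivial V := by
    by_contra h
    rw [not_nontrivial_iff_subsingleton] at h
    obtain ⟨S, S', hS⟩ := hirr.exists_pair_ne
    exact hS (Subrepresentation.toSubmodule_injective (Subsingleton.elim _ _))
  obtain ⟨x, hx, hx0⟩ := Submodule.exists_mem_ne_zero_of_ne_bot
    (whittakerSpace_zero_ne_bot hn hcusp hψ)
  refine existsUnique_of_exists_of_unique ?_ ?_
  · obtain ⟨e⟩ := hfix
    have he : ∀ g x, e.toLinearMap (ρ g x) = ρ (frobGL k' k n g) (e.toLinearMap x) :=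
      fun g x => LinearMap.congr_fun (e.isIntertwining' g) x
    have heinj : Function.Injective e.toLinearMap := e.toLinearEquiv.injective
    have hspan := whittakerSpace_eq_span hψ hirr hx hx0
    obtain ⟨a, ha⟩ := Submodule.mem_span_singleton.1 (hspan ▸ map_mem_whittakerSpace he hx)
    have ha0 : a ≠ 0 := by
      rintro rfl
      rw [zero_smul] at ha
      exact hx0 (heinj (by rw [map_zero, ← ha]))
    -- The isomorphism acts on the Whittaker line by `a`. After division by `a`, `T ^ l` intertwines
    -- `ρ` with itself and fixes `x`, so it is the identity on the whole orbit of `x`.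
    let T : Module.End (QlBar l) V := a⁻¹ • e.toLinearMap
    have hT : ∀ g x, T (ρ g x) = ρ (frobGL k' k n g) (T x) := fun g x => by
      simp only [T, LinearMap.smul_apply, map_smul, he]
    have hTx : T x = x := by
      simp only [T, LinearMap.smul_apply]
      rw [← ha, smul_smul, inv_mul_cancel₀ ha0, one_smul]
    refine ⟨T, hT, ?_, ?_⟩
    · refine eq_of_eq_on_orbit hirr hx0 fun g => ?_
      have hTd : ∀ d : ℕ, (T ^ d) x = x := by
        intro d
        induction d with
        | zero => rfl
        | succ d ih => rw [pow_succ', Module.End.mul_apply, ih, hTx]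
      have hF := frobGL_iterate_finrank (k' := k') g
      rw [hdeg] at hF
      rw [map_pow_map hT, hTd, hF]; rfl
    · intro z hz
      have hz' : z ∈ whittakerSpace ρ (traceChar k ε) 0 :=
        fun u hu => hz u (mem_unipotentUpper_zero.1 hu)
      rw [hspan] at hz'
      obtain ⟨b, rfl⟩ := Submodule.mem_span_singleton.1 hz'
      rw [map_smul, hTx]
  · intro T₁ T₂ h₁ h₂
    refine eq_of_eq_on_orbit hirr hx0 fun g => ?_
    rw [h₁.intertwines, h₂.intertwines, h₁.apply_of_mem hx, h₂.apply_of_mem hx]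

end Existence

/-! ### Lattices and the descent of Tate cohomology. -/

section Integrality

lemma coprime_card {l : ℕ} {k : Type*} [Field k] [Fintype k] (h : l.Coprime (ringChar k)) :
    l.Coprime (Fintype.card k) := by
  obtain ⟨m, -, hm⟩ := FiniteField.card k (ringChar k)
  rw [hm]
  exact Nat.Coprime.pow_right _ h

variable {l : ℕ} [Fact l.Prime]

lemma addChar_mem_ZlBar {A : Type*} [AddCommGroup A] [Finite A] (ε : AddChar A (QlBar l)) (a : A) :
    ε a ∈ ZlBar l := by
  have h : ε a ^ Nat.card A = 1 := by
    rw [← AddChar.map_nsmul_eq_pow, card_nsmul_eq_zero', AddChar.map_zero_eq_one]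
  exact IsIntegral.of_pow Nat.card_pos (h ▸ isIntegral_one)

lemma inv_natCast_mem_ZlBar {m : ℕ} (hm : l.Coprime m) : (m : QlBar l)⁻¹ ∈ ZlBar l := by
  have hu : IsUnit (m : ℤ_[l]) := by
    rw [PadicInt.isUnit_iff, PadicInt.norm_def, PadicInt.coe_natCast]
    exact Padic.norm_natCast_eq_one_iff.2 hm
  obtain ⟨v, hv⟩ := hu
  have h : (m : QlBar l)⁻¹ = algebraMap ℤ_[l] (QlBar l) (v⁻¹ : ℤ_[l]ˣ) := by
    refine inv_eq_of_mul_eq_one_right ?_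
    rw [← map_natCast (algebraMap ℤ_[l] (QlBar l)), ← hv, ← map_mul, Units.mul_inv, map_one]
  rw [h]
  exact Subalgebra.algebraMap_mem _ _

variable {k' : Type w} [Field k'] [Fintype k']
  {k : Type v} [Field k] [Algebra k' k] [Fintype k] {n : ℕ}
  {V : Type u} [AddCommGroup V] [Module (QlBar l) V]
  {ρ : Representation (QlBar l) (GL (Fin n) k) V} {ε : AddChar k' (QlBar l)}
  {T : Module.End (QlBar l) V} {L : Submodule (ZlBar l) V}

lemma smul_mem_of_mem_ZlBar {a : QlBar l} (ha : a ∈ ZlBar l) {x : V} (hx : x ∈ L) : a • x ∈ L :=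
  L.smul_mem (⟨a, ha⟩ : ZlBar l) hx

/-- The character values are roots of unity, and the order of `k^c` is an `l`-adic unit because the
characteristic is prime to `l`. -/
lemma columnProj_mem_lattice (hchar : l.Coprime (ringChar k)) (hL : IsInvariantLattice ρ L)
    (ψ : AddChar k (QlBar l)) {c : Fin n} (y : {i : Fin n // i < c} → k) {x : V} (hx : x ∈ L) :
    columnProj ρ ψ y x ∈ L := by
  rw [columnProj_apply]
  refine smul_mem_of_mem_ZlBar (inv_natCast_mem_ZlBar ?_) (Submodule.sum_mem _ fun v _ =>
    smul_mem_of_mem_ZlBar (addChar_mem_ZlBar ψ _) (hL.stable _ x hx))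
  rw [Fintype.card_fun]
  exact Nat.Coprime.pow_right _ (coprime_card hchar)

variable (ρ ε L) in
/-- The vectors of the lattice `L` that lie in `whittakerSpace ρ (traceChar k ε) c`. -/
def whittakerLattice (c : ℕ) : Submodule (ZlBar l) V :=
  (whittakerSpace ρ (traceChar k ε) c).restrictScalars (ZlBar l) ⊓ L

lemma map_mem_lattice [FiniteDimensional k' k] (hchar : l.Coprime (ringChar k))
    (hcusp : IsCuspidal ρ) (hε : ε ≠ 1) (hT : IsFrobOperator ρ ε T) (hL : IsInvariantLattice ρ L)
    (d : ℕ) (hd : d + 1 ≤ n) {x : V} (hx : x ∈ whittakerLattice ρ ε L (d + 1)) : T x ∈ L := by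
  have hψ := traceChar_isPrimitive (k := k) hε
  induction d generalizing x with
  | zero =>
    have h0 := hx.1
    rw [zero_add, whittakerSpace_one] at h0
    rw [hT.apply_of_mem h0]
    exact hx.2
  | succ d ih =>
    let c : Fin n := ⟨d + 1, hd⟩
    have hc : 0 < (c : ℕ) := Nat.succ_pos d
    rw [← sum_columnProj ρ (traceChar k ε) hψ c x, map_sum]
    refine Submodule.sum_mem _ fun y _ => ?_
    by_cases hy : y = 0
    · rw [hy, columnProj_zero hcusp _ hc hx.1, map_zero]
      exact zero_mem _
    obtain ⟨q, hq, hqy, -⟩ := exists_mirabolic_row hy (aboveDiag hc)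
    have hmem := (isColumnEigen_columnProj ρ (traceChar k ε) y x).map_mem hc
      (columnProj_mem ρ _ y hx.1) hq hqy
    have hqL := ih (by omega) ⟨hmem, hL.stable q _ (columnProj_mem_lattice hchar hL _ y hx.2)⟩
    -- For a component `w`, the intertwining relation gives `T w = ρ (Frob q⁻¹) (T (ρ q w))`, and `ρ
    -- q w` lies one stage lower.
    have h := hL.stable (frobGL k' k n q⁻¹) _ hqL
    rwa [← hT.intertwines, ← Module.End.mul_apply (ρ q⁻¹), ← map_mul, inv_mul_cancel, map_one,
      Module.End.one_apply] at h

/-- The induction yields a preimage within the same stage of the lattice, which is what allows it to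
be translated back by `q⁻¹`. -/
lemma mem_map_one_sub [FiniteDimensional k' k] (hdeg : Module.finrank k' k = l)
    (hchar : l.Coprime (ringChar k))
    (hcusp : IsCuspidal ρ) (hε : ε ≠ 1) (hT : IsFrobOperator ρ ε T) (hL : IsInvariantLattice ρ L)
    (d : ℕ) (hd : d + 1 ≤ n) {x : V} (hx : x ∈ whittakerLattice ρ ε L (d + 1))
    (hNx : tateNorm l (T.restrictScalars (ZlBar l)) x = 0) :
    x ∈ (whittakerLattice ρ ε L (d + 1)).map (1 - T.restrictScalars (ZlBar l)) := by
  have hψ := traceChar_isPrimitive (k := k) hε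
  have hpow : ∀ i : ℕ, (T.restrictScalars (ZlBar l)) ^ i = (T ^ i).restrictScalars (ZlBar l) := by
    intro i
    induction i with
    | zero => rfl
    | succ i ih => rw [pow_succ', pow_succ', ih]; rfl
  have hN : ∀ x, tateNorm l (T.restrictScalars (ZlBar l)) x = tateNorm l T x := fun x => by
    rw [tateNorm_apply, tateNorm_apply]
    exact Finset.sum_congr rfl fun i _ => by rw [hpow]; rfl
  induction d generalizing x with
  | zero =>
    have h0 := hx.1
    rw [zero_add, whittakerSpace_one] at h0
    have hTd : ∀ i : ℕ, (T ^ i) x = x := by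
      intro i
      induction i with
      | zero => rfl
      | succ i ih => rw [pow_succ', Module.End.mul_apply, ih, hT.apply_of_mem h0]
    rw [hN, tateNorm_apply, Finset.sum_congr rfl fun i _ => hTd i, Finset.sum_const,
      Finset.card_range, ← Nat.cast_smul_eq_nsmul (QlBar l)] at hNx
    -- On Whittaker vectors the norm is multiplication by `l`, which is injective.
    have hl0 : (l : QlBar l) ≠ 0 := Nat.cast_ne_zero.2 (Fact.out : l.Prime).ne_zero
    rw [(smul_eq_zero.1 hNx).resolve_left hl0]
    exact zero_mem _
  | succ d ih =>
    let c : Fin n := ⟨d + 1, hd⟩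
    have hc : 0 < (c : ℕ) := Nat.succ_pos d
    have hPM : ∀ (y : {i : Fin n // i < c} → k) (x : V), x ∈ whittakerLattice ρ ε L (d + 1 + 1) →
        columnProj ρ (traceChar k ε) y x ∈ whittakerLattice ρ ε L (d + 1 + 1) := fun y x hx =>
      ⟨columnProj_mem (c := c) ρ _ y hx.1, columnProj_mem_lattice hchar hL _ y hx.2⟩
    have hTM : ∀ z ∈ whittakerLattice ρ ε L (d + 1 + 1),
        T.restrictScalars (ZlBar l) z ∈ whittakerLattice ρ ε L (d + 1 + 1) := fun z hz =>
      ⟨map_mem_whittakerSpace hT.intertwines hz.1,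
        map_mem_lattice hchar hcusp hε hT hL (d + 1) hd hz⟩
    refine mem_map_one_sub_of_decomposition (Fact.out : l.Prime) hTM
      (φ := fun (y : {i : Fin n // i < c} → k) i => FiniteField.frobeniusAlgHom k' k (y i))
      (fun y => ?_)
      (fun y => (columnProj ρ (traceChar k ε) y).restrictScalars (ZlBar l))
      (fun x => sum_columnProj ρ (traceChar k ε) hψ c x) hPM
      (fun y x => map_columnProj hT.intertwines y x) hx hNx (fun y hy => ?_)
    · have h : ∀ (m : ℕ) (y : {i : Fin n // i < c} → k) i,
          (fun (y : {i : Fin n // i < c} → k) i => FiniteField.frobeniusAlgHom k' k (y i))^[m] y i =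
          (FiniteField.frobeniusAlgHom k' k)^[m] (y i) := by
        intro m
        induction m with
        | zero => intro y i; rfl
        | succ m ih => intro y i; rw [Function.iterate_succ_apply, ih]; rfl
      ext i
      have hF := frobenius_iterate_finrank (k' := k') (y i)
      rw [hdeg] at hF
      rw [h, hF]
    · rw [LinearMap.restrictScalars_apply]
      by_cases hy0 : y = 0
      · rw [hy0, columnProj_zero hcusp _ hc hx.1]
        exact zero_mem _
      obtain ⟨q, hq, hqy, hqF⟩ := exists_mirabolic_row hy0 (aboveDiag hc)
      -- A Frobenius-fixed `y` gives a fixed `q`, so `ρ q` commutes with `T` and the translated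
      -- component still has norm zero.
      have hFq : frobGL k' k n q = q := hqF _ fun i => congrFun hy i
      have hFq' : frobGL k' k n q⁻¹ = q⁻¹ := by rw [map_inv, hFq]
      have hTiq : ∀ (i : ℕ) z, (T ^ i) (ρ q z) = ρ q ((T ^ i) z) := fun i z => by
        rw [map_pow_map hT.intertwines, Function.iterate_fixed hFq]
      have hTiP : ∀ i : ℕ, (T ^ i) (columnProj ρ (traceChar k ε) y x) =
          columnProj ρ (traceChar k ε) y ((T ^ i) x) := by
        intro i
        induction i with
        | zero => rfl
        | succ i ih =>
          rw [pow_succ', Module.End.mul_apply, ih, map_columnProj hT.intertwines, hy]; rfl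
      have hmem := (isColumnEigen_columnProj ρ (traceChar k ε) y x).map_mem hc
        (columnProj_mem ρ _ y hx.1) hq hqy
      obtain ⟨z, hz, hzx⟩ := ih (by omega)
        ⟨hmem, hL.stable q _ (columnProj_mem_lattice hchar hL _ y hx.2)⟩ (by
          rw [hN, tateNorm_apply] at hNx ⊢
          simp only [hTiq, hTiP]
          rw [← map_sum, ← map_sum, hNx, map_zero, map_zero])
      refine ⟨ρ q⁻¹ z, ⟨mirabolic_map_mem (c := c) (inv_mem hq)
        (whittakerSpace_mono (Nat.le_succ _) hz.1), hL.stable _ z hz.2⟩, ?_⟩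
      have h := congrArg (ρ q⁻¹) hzx
      rw [← Module.End.mul_apply (ρ q⁻¹) (ρ q), ← map_mul, inv_mul_cancel, map_one,
        Module.End.one_apply] at h
      rw [← h]
      simp only [LinearMap.sub_apply, Module.End.one_apply, LinearMap.restrictScalars_apply,
        map_sub, hT.intertwines, hFq']

end Integrality

end TateGL

end

/-! ### The main theorem. -/

theorem mainTheorem7 {l : ℕ} [Fact l.Prime]
    {k' : Type*} [Field k'] [Fintype k'] {k : Type*} [Field k] [Algebra k' k]
    (hdeg : Module.finrank k' k = l) (hchar : l.Coprime (ringChar k))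
    {n : ℕ} (hn : 2 ≤ n)
    {V : Type*} [AddCommGroup V] [Module (TateGL.QlBar l) V]
    (ρ : Representation (TateGL.QlBar l) (GL (Fin n) k) V)
    (hirr : ρ.IsIrreducible) (hcusp : TateGL.IsCuspidal ρ)
    (hint : TateGL.IsIntegralRep ρ) (hfix : TateGL.IsFrobFixed k' ρ)
    (ε : AddChar k' (TateGL.QlBar l)) (hε : ε ≠ 1) :
    (∃! T : Module.End (TateGL.QlBar l) V, TateGL.IsFrobOperator ρ ε T) ∧
    ∀ T : Module.End (TateGL.QlBar l) V, TateGL.IsFrobOperator ρ ε T →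
      ∀ L : Submodule (TateGL.ZlBar l) V, TateGL.IsInvariantLattice ρ L →
        ∃ hT : ∀ x ∈ L, T.restrictScalars (TateGL.ZlBar l) x ∈ L,
          Subsingleton (TateGL.TateH1 l ((T.restrictScalars (TateGL.ZlBar l)).restrict hT)) := by
  have hl : l.Prime := Fact.out
  have : FiniteDimensional k' k := Module.finite_of_finrank_pos (by rw [hdeg]; exact hl.pos)
  have : Finite k := Module.finite_of_finite k'
  have : Fintype k := Fintype.ofFinite k
  have : FiniteDimensional (TateGL.QlBar l) V := by
    obtain ⟨L, hL⟩ := hint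
    obtain ⟨s, hs⟩ := hL.isLattice.fg
    refine ⟨⟨s, ?_⟩⟩
    rw [← hL.isLattice.span_eq_top, ← hs, Submodule.span_span_of_tower]
  refine ⟨TateGL.existsUnique_isFrobOperator hdeg (by omega) hirr hcusp hfix hε, ?_⟩
  intro T hT L hL
  -- At stage `n` the Whittaker condition is empty, so the whole lattice is covered.
  obtain ⟨d, rfl⟩ : ∃ d, n = d + 1 := ⟨n - 1, by omega⟩
  have hmem : ∀ x ∈ L, x ∈ TateGL.whittakerLattice ρ ε L (d + 1) :=
    fun x hx => ⟨TateGL.mem_whittakerSpace_self x, hx⟩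
  have hTL : ∀ x ∈ L, T.restrictScalars (TateGL.ZlBar l) x ∈ L :=
    fun x hx => TateGL.map_mem_lattice hchar hcusp hε hT hL d le_rfl (hmem x hx)
  refine ⟨hTL, Submodule.Quotient.subsingleton_iff.2 (Submodule.submoduleOf_eq_top.2 ?_)⟩
  intro x hx
  rw [LinearMap.mem_ker, TateGL.tateNorm_apply] at hx
  have hx' := congrArg Subtype.val hx
  obtain ⟨z, hz, hzx⟩ := TateGL.mem_map_one_sub hdeg hchar hcusp hε hT hL d le_rfl (hmem x x.2) (by
    rw [TateGL.tateNorm_apply]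
    refine Eq.trans ?_ hx'
    rw [AddSubmonoidClass.coe_finsetSum]
    refine Finset.sum_congr rfl fun i hi => ?_
    clear hi
    induction i with
    | zero => rfl
    | succ i ih => rw [pow_succ', pow_succ', Module.End.mul_apply, ih]; rfl)
  exact ⟨⟨z, hz.2⟩, Subtype.ext hzx⟩
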